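/- Let $B_0$ be an infinite-dimensional UHF algebra: a unital C*-algebra with an increasing sequence of unital *-subalgebras $B_{0,1}\subset B_{0,2}\subset\cdots$ with norm-dense union, where $B_{0,n}\simeq \mathbb M_{k_n}(\mathbb C)$, $k_n\mid k_{n+1}$ and $k_n\to\infty$. Then $B_0$ has a unique tracial state $\tau$. Let $B_0\to\mathcal B(\mathcal H)$ be a unital *-representation on a separable Hilbert space $\mathcal H$, and let $(\xi_m)_m$ be a sequence of unit vectors that is dense in the set of unit vectors of $\mathcal H$. For a unit vector $\xi$ denote by $\varphi_\xi(b)=\langle b\xi,\xi\rangle$ the state on $B_0$ implemented by $\xi$. The following conditions are equivalent: 1. the von Neumann algebra $B_0''$ generated by (the image of) $B_0$ in $\mathcal B(\mathcal H)$ is the hyperfinite $\mathrm{II}_1$ factor, that is, it is an infinite-dimensional factor with a faithful normal tracial state, and it is generated as a von Neumann algebra by an increasing sequence of finite-dimensional *-subalgebras; 2. for every unit vector $\xi\in\mathcal H$, $\displaystyle\lim_{n\to\infty}\bigl\|(\tau-\varphi_\xi)|_{B_{0,n}'\cap B_0}\bigr\|=0$; 3. for every $m$, $\displaystyle\lim_{n\to\infty}\bigl\|(\tau-\varphi_{\xi_m})|_{B_{0,n}'\cap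 B_0}\bigr\|=0$. Here $B_{0,n}'\cap B_0=\{b\in B_0 : ba=ab \text{ for all } a\in B_{0,n}\}$, and the norm is that of bounded linear functionals. -/

import Mathlib

open Filter Topology
open scoped ComplexOrder InnerProductSpace

/-- `B 0 ⊆ B 1 ⊆ ...` exhibits the unital C*-algebra `A` as a UHF algebra: the `B n` are unital
*-subalgebras, `B n` is *-isomorphic to the `k n × k n` complex matrices, `k n ∣ k (n + 1)`,
the union of the `B n` is norm dense in `A` (so that `A` is their C*-inductive limit), and
`k n → ∞`, that is, `A` is not itself a matrix algebra. -/
structure IsUHFSequence {A : Type*} [CStarAlgebra A]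
    (B : ℕ → StarSubalgebra ℂ A) (k : ℕ → ℕ) : Prop where
  mono : Monotone B
  matrix : ∀ n, Nonempty (B n ≃⋆ₐ[ℂ] Matrix (Fin (k n)) (Fin (k n)) ℂ)
  dvd : ∀ n, k n ∣ k (n + 1)
  dense : Dense (⋃ n, (B n : Set A))
  unbounded : Tendsto k atTop atTop

/-- A tracial state: a unital positive functional with `τ (a * b) = τ (b * a)`. -/
structure IsTracialState {A : Type*} [Ring A] [StarRing A] [Algebra ℂ A]
    (τ : A →ₗ[ℂ] ℂ) : Prop where
  map_one : τ 1 = 1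
  nonneg : ∀ a, 0 ≤ τ (star a * a)
  trace : ∀ a b, τ (a * b) = τ (b * a)

/-- The norm of the restriction of a bounded functional `f` to the *-subalgebra `C`. -/
noncomputable def restrictNorm {A : Type*} [CStarAlgebra A] (f : StrongDual ℂ A)
    (C : StarSubalgebra ℂ A) : ℝ :=
  ‖f.comp (Subalgebra.toSubmodule C.toSubalgebra).subtypeL‖

section Hilbert

variable {H : Type*} [NormedAddCommGroup H] [InnerProductSpace ℂ H] [CompleteSpace H]

/-- The functional `a ↦ ⟪ξ, π a ξ⟫` implemented by the vector `ξ` in the representation `π`;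
it is a state if `ξ` is a unit vector. -/
noncomputable def vectorFunctional {A : Type*} [CStarAlgebra A] (π : A →⋆ₐ[ℂ] (H →L[ℂ] H))
    (ξ : H) : StrongDual ℂ A :=
  (innerSL ℂ ξ).comp ((ContinuousLinearMap.apply ℂ H ξ).comp
    ⟨π.toAlgHom.toLinearMap, AddMonoidHomClass.continuous_of_bound π 1 fun a => by
      simpa only [one_mul] using NonUnitalStarAlgHom.norm_apply_le π a⟩)

theorem vectorFunctional_apply {A : Type*} [CStarAlgebra A] (π : A →⋆ₐ[ℂ] (H →L[ℂ] H))
    (ξ : H) (a : A) : vectorFunctional π ξ a = ⟪ξ, π a ξ⟫_ℂ := rfl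

/-- The von Neumann algebra `S''` generated by a unital *-subalgebra `S` of the bounded
operators. -/
noncomputable def bicommutant (S : StarSubalgebra ℂ (H →L[ℂ] H)) : VonNeumannAlgebra H where
  toStarSubalgebra := StarSubalgebra.centralizer ℂ
    (StarSubalgebra.centralizer ℂ (S : Set (H →L[ℂ] H)) : Set (H →L[ℂ] H))
  centralizer_centralizer' := by
    change Set.centralizer (Set.centralizer (SetLike.coe (StarSubalgebra.centralizer ℂ _))) =
      SetLike.coe (StarSubalgebra.centralizer ℂ _)
    rw [StarSubalgebra.coe_centralizer, Set.centralizer_centralizer_centralizer]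

theorem coe_bicommutant (S : StarSubalgebra ℂ (H →L[ℂ] H)) :
    (bicommutant S : Set (H →L[ℂ] H)) =
      Set.centralizer (Set.centralizer (S : Set (H →L[ℂ] H))) := by
  have star_eq : ∀ T : StarSubalgebra ℂ (H →L[ℂ] H),
      (T : Set (H →L[ℂ] H)) ∪ star (T : Set (H →L[ℂ] H)) = T := by
    intro T
    apply Set.union_eq_self_of_subset_right
    intro x hx
    simpa using star_mem (S := StarSubalgebra ℂ (H →L[ℂ] H)) (s := T) hx
  change SetLike.coe (StarSubalgebra.centralizer ℂ _) = _
  rw [StarSubalgebra.coe_centralizer, star_eq, StarSubalgebra.coe_centralizer, star_eq]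

/-- Normality of a functional on a von Neumann algebra: its restriction to the unit ball is
continuous for the weak operator topology (equivalently, it is ultraweakly continuous). -/
def IsNormalFunctional (M : VonNeumannAlgebra H) (T : M.toStarSubalgebra →ₗ[ℂ] ℂ) : Prop :=
  Continuous fun x : {x : H →WOT[ℂ] H //
    x.toCLM ∈ M.toStarSubalgebra ∧ ‖x.toCLM‖ ≤ 1} => T ⟨x.1.toCLM, x.2.1⟩

/-- A II₁ factor: an infinite-dimensional von Neumann algebra with center reduced to the
scalars and with a faithful normal tracial state. -/
structure IsIIOneFactor (M : VonNeumannAlgebra H) : Prop where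
  factor : ∀ x ∈ M, x ∈ M.commutant → ∃ c : ℂ, x = c • (1 : H →L[ℂ] H)
  infinite : ¬ FiniteDimensional ℂ M.toStarSubalgebra
  trace : ∃ T : M.toStarSubalgebra →ₗ[ℂ] ℂ, IsTracialState T ∧ IsNormalFunctional M T ∧
    ∀ x, T (star x * x) = 0 → x = 0

/-- Hyperfiniteness (approximate finite dimensionality): `M` is generated as a von Neumann
algebra by an increasing sequence of finite-dimensional *-subalgebras. -/
def IsHyperfinite (M : VonNeumannAlgebra H) : Prop :=
  ∃ Q : ℕ → StarSubalgebra ℂ (H →L[ℂ] H), Monotone Q ∧ (∀ n, FiniteDimensional ℂ (Q n)) ∧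
    (M : Set (H →L[ℂ] H)) =
      Set.centralizer (Set.centralizer (⋃ n, (Q n : Set (H →L[ℂ] H))))

/-- `M` is (a copy of) the hyperfinite II₁ factor, the II₁ factor that is approximately finite
dimensional; it is unique up to *-isomorphism by Murray and von Neumann. -/
def IsHyperfiniteIIOneFactor (M : VonNeumannAlgebra H) : Prop :=
  IsIIOneFactor M ∧ IsHyperfinite M

end Hilbert

/-!
The trace and the representation are compared through averages over the matrix algebras. Matrix
units `e i j` of `B n` define the average `E_n(x) = k⁻¹ ∑ e i j * x * e j i`, the conditional
expectation onto the relative commutant of `B n`. It satisfies `E_n(b x) = E_n(x b)` for `b` in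
`B n`, maps `B n` to the scalars, and is invariant under every trace. Hence a tracial state is
determined on the dense union of the `B n`, and limits of the averages `φ_ξ ∘ E_n` of vector states
along an ultrafilter are tracial, so that there is exactly one tracial state `τ`.

Suppose that `τ - φ_ξ` is asymptotically small on the relative commutants. As `τ = τ ∘ E_n`, the
functional `φ_ξ ∘ E_n` is then uniformly close to `τ` on the unit ball of `A`. It is a finite sum of
vector functionals, so by the Kaplansky density theorem (`exists_filter_tendsto`) the functionals
`φ_ξ ∘ E_n` form a Cauchy sequence on the von Neumann algebra `M` generated by `A`, and their limit
`T` is a normal trace which does not depend on `ξ` (`exists_trace_on_bicommutant`). A central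
element `x` of `M` is fixed by all averages, so `⟪ξ, x ξ⟫ = T x` for all unit vectors `ξ`, and `x`
is a scalar (`eq_smul_one_of_mem_of_mem_commutant`). A null element of `T` produces elements of the
null ideal that commute with `B n` and nearly fix a given unit vector, against the smallness of
`T - φ_ξ` on the relative commutant; so `T` is faithful
(`eq_zero_of_trace_star_mul_self_eq_zero`).

Conversely, in a II₁ factor with normal trace `T` one has `T ∘ π = τ` by uniqueness. For
contractions `b n` in the relative commutants of the `B n`, every weak limit point of `π (b n)`
lies in the centre of `M`, so it is a scalar, to which both `τ (b n)` and `φ_ξ (b n)` converge; so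
`τ - φ_ξ` tends to `0` in norm on the relative commutants (`tendsto_restrictNorm_of_isIIOneFactor`).
-/

/-! ### Matrix units and averages over a matrix algebra -/

/-- A full system of matrix units in a unital *-ring: `e i j * e k l = δ_{jk} e i l`,
`(e i j)* = e j i` and `∑ i, e i i = 1`. -/
structure IsMatrixUnits {R ι : Type*} [Ring R] [StarRing R] [Fintype ι] [DecidableEq ι]
    (e : ι → ι → R) : Prop where
  mul : ∀ i j p q, e i j * e p q = if j = p then e i q else 0
  star_eq : ∀ i j, star (e i j) = e j i
  sum_one : ∑ i, e i i = 1

/-- The average `x ↦ k⁻¹ ∑ i j, e i j * x * (e i j)*` over the matrix algebra spanned by `k × k`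
matrix units. It is the conditional expectation onto the relative commutant of that matrix
algebra, and it equals the average over the unitary group of the matrix algebra; the matrix
units make it a finite sum. -/
noncomputable def matrixAverage {R ι : Type*} [Ring R] [Algebra ℂ R] [Fintype ι]
    (e : ι → ι → R) : R →ₗ[ℂ] R where
  toFun x := (Fintype.card ι : ℂ)⁻¹ • ∑ i, ∑ j, e i j * x * e j i
  map_add' x y := by simp only [mul_add, add_mul, Finset.sum_add_distrib, smul_add]
  map_smul' c x := by
    simp only [mul_smul_comm, smul_mul_assoc, ← Finset.smul_sum, RingHom.id_apply]
    rw [smul_comm]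

theorem matrixAverage_apply {R ι : Type*} [Ring R] [Algebra ℂ R] [Fintype ι]
    (e : ι → ι → R) (x : R) :
    matrixAverage e x = (Fintype.card ι : ℂ)⁻¹ • ∑ i, ∑ j, e i j * x * e j i := rfl

theorem IsMatrixUnits.matrixAverage_mul_left {R ι : Type*} [Ring R] [Algebra ℂ R] [Fintype ι]
    {e : ι → ι → R} {m : R} (hm : ∀ i j, e i j * m = m * e i j) (x : R) :
    matrixAverage e (m * x) = m * matrixAverage e x := by
  simp only [matrixAverage_apply, mul_smul_comm, Finset.mul_sum, ← mul_assoc, hm]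

theorem IsMatrixUnits.matrixAverage_mul_right {R ι : Type*} [Ring R] [Algebra ℂ R] [Fintype ι]
    {e : ι → ι → R} {m : R} (hm : ∀ i j, e i j * m = m * e i j) (x : R) :
    matrixAverage e (x * m) = matrixAverage e x * m := by
  simp only [matrixAverage_apply, smul_mul_assoc, Finset.sum_mul, mul_assoc, hm]

namespace IsMatrixUnits

variable {R ι : Type*} [Ring R] [StarRing R] [Fintype ι] [DecidableEq ι] {e : ι → ι → R}

theorem map {S F : Type*} [Ring S] [StarRing S] [FunLike F R S] [RingHomClass F R S]
    [StarHomClass F R S] (he : IsMatrixUnits e) (f : F) :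
    IsMatrixUnits (fun i j => f (e i j)) where
  mul i j p q := by rw [← map_mul, he.mul]; split_ifs <;> simp
  star_eq i j := by rw [← map_star, he.star_eq]
  sum_one := by rw [← map_sum, he.sum_one, map_one]

theorem ne_zero [Nontrivial R] (he : IsMatrixUnits e) (i : ι) : e i i ≠ 0 := by
  intro h
  refine one_ne_zero (α := R) ?_
  rw [← he.sum_one]
  refine Finset.sum_eq_zero fun j _ => ?_
  have h1 : e j i * e i i * e i j = e j j := by simp [he.mul]
  rw [← h1, h, mul_zero, zero_mul]

theorem linearIndependent_diag [Nontrivial R] [Algebra ℂ R] (he : IsMatrixUnits e) :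
    LinearIndependent ℂ (fun i => e i i) := by
  rw [Fintype.linearIndependent_iff]
  intro c hc i
  have h := congrArg (· * e i i) hc
  simp only [Finset.sum_mul, smul_mul_assoc, he.mul, zero_mul, smul_ite, smul_zero,
    Finset.sum_ite_eq', Finset.mem_univ, if_true] at h
  exact (smul_eq_zero.mp h).resolve_right (he.ne_zero i)

variable [Algebra ℂ R]

theorem commute_matrixAverage (he : IsMatrixUnits e) (p q : ι) (x : R) :
    e p q * matrixAverage e x = matrixAverage e x * e p q := by
  rw [matrixAverage_apply, mul_smul_comm, smul_mul_assoc]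
  congr 1
  have h1 : e p q * ∑ i, ∑ j, e i j * x * e j i = ∑ j, e p j * x * e j q := by
    simp [Finset.mul_sum, ← mul_assoc, he.mul, ite_mul, Finset.sum_ite_eq]
  have h2 : (∑ i, ∑ j, e i j * x * e j i) * e p q = ∑ j, e p j * x * e j q := by
    simp [Finset.sum_mul, mul_assoc, he.mul, mul_ite]
  rw [h1, h2]

theorem matrixAverage_mul_comm (he : IsMatrixUnits e) (p q : ι) (x : R) :
    matrixAverage e (e p q * x) = matrixAverage e (x * e p q) := by
  simp only [matrixAverage_apply]
  congr 1
  refine Finset.sum_congr rfl fun i _ => ?_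
  have h1 : ∑ j, e i j * (e p q * x) * e j i = e i q * x * e p i := by
    simp [← mul_assoc, he.mul, ite_mul]
  have h2 : ∑ j, e i j * (x * e p q) * e j i = e i q * x * e p i := by
    simp [mul_assoc, he.mul, mul_ite]
  rw [h1, h2]

theorem sum_sum_diag (he : IsMatrixUnits e) :
    ∑ i, ∑ j, e i j * e j i = (Fintype.card ι : ℂ) • (1 : R) := by
  have h : ∀ i, ∑ j, e i j * e j i = (Fintype.card ι : ℂ) • e i i := fun i => by
    simp [he.mul, Nat.cast_smul_eq_nsmul]
  simp only [h, ← Finset.smul_sum, he.sum_one]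

theorem matrixAverage_one [Nonempty ι] (he : IsMatrixUnits e) : matrixAverage e 1 = 1 := by
  have hk : (Fintype.card ι : ℂ) ≠ 0 := by simp
  rw [matrixAverage_apply]
  simp only [mul_one]
  rw [he.sum_sum_diag, inv_smul_smul₀ hk]

theorem matrixAverage_of_commute [Nonempty ι] (he : IsMatrixUnits e) {m : R}
    (hm : ∀ i j, e i j * m = m * e i j) : matrixAverage e m = m := by
  have h := matrixAverage_mul_left hm 1
  rwa [he.matrixAverage_one, mul_one] at h

theorem apply_matrixAverage [Nonempty ι] (he : IsMatrixUnits e) {τ : R →ₗ[ℂ] ℂ}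
    (hτ : ∀ a b, τ (a * b) = τ (b * a)) (x : R) : τ (matrixAverage e x) = τ x := by
  have hk : (Fintype.card ι : ℂ) ≠ 0 := by simp
  have h : ∀ i j, τ (e i j * x * e j i) = τ (x * (e j i * e i j)) := fun i j => by
    rw [mul_assoc, hτ, mul_assoc]
  rw [matrixAverage_apply]
  simp only [map_smul, map_sum, h]
  simp only [← map_sum, ← Finset.mul_sum]
  rw [Finset.sum_comm, he.sum_sum_diag, mul_smul_comm, mul_one, map_smul, inv_smul_smul₀ hk]

theorem matrixAverage_mem_span_one (he : IsMatrixUnits e) {b : R}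
    (hb : b ∈ Submodule.span ℂ (Set.range fun p : ι × ι => e p.1 p.2)) :
    ∃ c : ℂ, matrixAverage e b = c • (1 : R) := by
  induction hb using Submodule.span_induction with
  | mem x hx =>
    obtain ⟨⟨p, q⟩, rfl⟩ := hx
    refine ⟨if p = q then (Fintype.card ι : ℂ)⁻¹ else 0, ?_⟩
    have h : ∀ i, ∑ j, e i j * e p q * e j i = if p = q then e i i else 0 := fun i => by
      simp only [he.mul, ite_mul, zero_mul, Finset.sum_ite_eq', Finset.mem_univ, if_true]
      simp [eq_comm]
    simp only [matrixAverage_apply, h]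
    split_ifs <;> simp [he.sum_one]
  | zero => exact ⟨0, by simp⟩
  | add x y _ _ hx hy =>
    obtain ⟨c, hc⟩ := hx
    obtain ⟨d, hd⟩ := hy
    exact ⟨c + d, by rw [map_add, hc, hd, add_smul]⟩
  | smul a x _ hx =>
    obtain ⟨c, hc⟩ := hx
    exact ⟨a * c, by rw [map_smul, hc, smul_smul]⟩

theorem star_matrixAverage [StarModule ℂ R] (he : IsMatrixUnits e) (x : R) :
    star (matrixAverage e x) = matrixAverage e (star x) := by
  simp only [matrixAverage_apply, star_smul, star_sum, star_mul, he.star_eq, mul_assoc]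
  simp

end IsMatrixUnits

theorem map_matrixAverage {R S ι F : Type*} [Ring R] [Ring S] [Algebra ℂ R] [Algebra ℂ S]
    [Fintype ι] [FunLike F R S] [AlgHomClass F ℂ R S] (f : F) (e : ι → ι → R) (x : R) :
    f (matrixAverage e x) = matrixAverage (fun i j => f (e i j)) (f x) := by
  simp [matrixAverage_apply]

section CStar

variable {A ι : Type*} [CStarAlgebra A] [Fintype ι] [DecidableEq ι] {e : ι → ι → A}

theorem IsMatrixUnits.matrixAverage_nonneg [PartialOrder A] [StarOrderedRing A]
    (he : IsMatrixUnits e) {y : A} (hy : 0 ≤ y) : 0 ≤ matrixAverage e y := by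
  have h1 : 0 ≤ ∑ i, ∑ j, e i j * y * e j i := by
    refine Finset.sum_nonneg fun i _ => Finset.sum_nonneg fun j _ => ?_
    rw [← he.star_eq i j]
    exact star_right_conjugate_nonneg hy _
  have h2 : matrixAverage e y
      = ((Fintype.card ι : ℝ)⁻¹) • ∑ i, ∑ j, e i j * y * e j i := by
    rw [matrixAverage_apply, ← Complex.coe_smul]
    push_cast
    rfl
  rw [h2]
  exact smul_nonneg (by positivity) h1

/-- The average is a contraction. By the Kadison–Schwarz inequality
`E(x)* E(x) ≤ E(x* x) ≤ ‖x‖²`, whose first half is the positivity of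
`E ((x - E x)* (x - E x))`. -/
theorem IsMatrixUnits.norm_matrixAverage_le [Nonempty ι] (he : IsMatrixUnits e) (x : A) :
    ‖matrixAverage e x‖ ≤ ‖x‖ := by
  let := CStarAlgebra.spectralOrder A
  let := CStarAlgebra.spectralOrderedRing A
  have hpos : ∀ y : A, 0 ≤ y → 0 ≤ matrixAverage e y := fun y hy => he.matrixAverage_nonneg hy
  set m := matrixAverage e x with hm
  have hcomm : ∀ i j, e i j * m = m * e i j := fun i j => he.commute_matrixAverage i j x
  have hcomm' : ∀ i j, e i j * star m = star m * e i j := fun i j => by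
    rw [he.star_matrixAverage]; exact he.commute_matrixAverage i j _
  have hkad : star m * m ≤ matrixAverage e (star x * x) := by
    have h := hpos _ (star_mul_self_nonneg (x - m))
    have h3 : matrixAverage e (star (x - m) * (x - m))
        = matrixAverage e (star x * x) - star m * m := by
      rw [star_sub, sub_mul, mul_sub, mul_sub, map_sub, map_sub, map_sub,
        IsMatrixUnits.matrixAverage_mul_right hcomm, IsMatrixUnits.matrixAverage_mul_left hcomm',
        IsMatrixUnits.matrixAverage_mul_right hcomm, he.matrixAverage_of_commute hcomm',
        ← he.star_matrixAverage, ← hm]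
      abel
    rw [h3] at h
    exact sub_nonneg.mp h
  have hle : matrixAverage e (star x * x) ≤ algebraMap ℝ A (‖x‖ ^ 2) := by
    have h := hpos _ (sub_nonneg.mpr (CStarAlgebra.star_mul_le_algebraMap_norm_sq (a := x)))
    rw [map_sub] at h
    have h4 : matrixAverage e (algebraMap ℝ A (‖x‖ ^ 2)) = algebraMap ℝ A (‖x‖ ^ 2) :=
      he.matrixAverage_of_commute fun i j => (Algebra.commutes _ _).symm
    rw [h4] at h
    exact sub_nonneg.mp h
  have h5 : ‖star m * m‖ ≤ ‖x‖ ^ 2 :=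
    (CStarAlgebra.norm_le_iff_le_algebraMap _ (by positivity) (star_mul_self_nonneg m)).mpr
      (hkad.trans hle)
  rw [CStarRing.norm_star_mul_self] at h5
  nlinarith [norm_nonneg m, norm_nonneg x]

end CStar

/-! ### Tracial states of a UHF algebra -/

namespace IsUHFSequence

variable {A : Type*} [CStarAlgebra A] {B : ℕ → StarSubalgebra ℂ A} {k : ℕ → ℕ}

theorem pos (hB : IsUHFSequence B k) (n : ℕ) : 0 < k n := by
  obtain ⟨m, hm, h1⟩ := ((eventually_ge_atTop n).and
    (hB.unbounded.eventually (eventually_ge_atTop 1))).exists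
  have hdvd : k n ∣ k m := Nat.le_induction dvd_rfl (fun j _ h => h.trans (hB.dvd j)) m hm
  exact Nat.pos_of_dvd_of_pos hdvd h1

theorem exists_matrixUnits (hB : IsUHFSequence B k) (n : ℕ) :
    ∃ e : Fin (k n) → Fin (k n) → A, IsMatrixUnits e ∧
      Submodule.span ℂ (Set.range fun p : Fin (k n) × Fin (k n) => e p.1 p.2)
        = Subalgebra.toSubmodule (B n).toSubalgebra := by
  obtain ⟨φ⟩ := hB.matrix n
  let u : Fin (k n) → Fin (k n) → Matrix (Fin (k n)) (Fin (k n)) ℂ :=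
    fun i j => Matrix.single i j 1
  have hu : IsMatrixUnits u :=
    { mul := fun i j p q => by
        by_cases h : j = p
        · subst h; simp [u]
        · simp [u, h]
      star_eq := fun i j => by simp [u, Matrix.star_eq_conjTranspose, Matrix.conjTranspose_single]
      sum_one := by
        ext a b
        simp [u, Matrix.sum_apply, Matrix.single_apply, Matrix.one_apply, ite_and] }
  have hspan : Submodule.span ℂ (Set.range fun p : Fin (k n) × Fin (k n) => u p.1 p.2) = ⊤ := by
    rw [eq_top_iff]
    intro x _
    rw [Matrix.matrix_eq_sum_single x]
    refine Submodule.sum_mem _ fun i _ => Submodule.sum_mem _ fun j _ => ?_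
    have h : Matrix.single i j (x i j) = x i j • u i j := by simp [u]
    rw [h]
    exact Submodule.smul_mem _ _ (Submodule.subset_span ⟨(i, j), rfl⟩)
  let f : Matrix (Fin (k n)) (Fin (k n)) ℂ →⋆ₐ[ℂ] A :=
    (B n).subtype.comp (φ.symm : Matrix (Fin (k n)) (Fin (k n)) ℂ →⋆ₐ[ℂ] B n)
  refine ⟨fun i j => f (u i j), hu.map f, ?_⟩
  have h1 := congrArg (Submodule.map f.toAlgHom.toLinearMap) hspan
  rw [Submodule.map_span, ← Set.range_comp] at h1
  refine h1.trans ?_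
  ext a
  simp only [Submodule.map_top, LinearMap.mem_range]
  constructor
  · rintro ⟨x, rfl⟩
    exact (φ.symm x).2
  · intro ha
    exact ⟨φ ⟨a, ha⟩, by simp [f]⟩

/-- Matrix units spanning the `n`-th matrix algebra of a UHF sequence. -/
noncomputable def unit (hB : IsUHFSequence B k) (n : ℕ) : Fin (k n) → Fin (k n) → A :=
  (hB.exists_matrixUnits n).choose

theorem isMatrixUnits (hB : IsUHFSequence B k) (n : ℕ) : IsMatrixUnits (hB.unit n) :=
  (hB.exists_matrixUnits n).choose_spec.1

theorem span_unit (hB : IsUHFSequence B k) (n : ℕ) :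
    Submodule.span ℂ (Set.range fun p : Fin (k n) × Fin (k n) => hB.unit n p.1 p.2)
      = Subalgebra.toSubmodule (B n).toSubalgebra :=
  (hB.exists_matrixUnits n).choose_spec.2

theorem nonempty_fin (hB : IsUHFSequence B k) (n : ℕ) : Nonempty (Fin (k n)) :=
  ⟨⟨0, hB.pos n⟩⟩

theorem mem_span (hB : IsUHFSequence B k) {n : ℕ} {b : A} (hb : b ∈ B n) :
    b ∈ Submodule.span ℂ (Set.range fun p : Fin (k n) × Fin (k n) => hB.unit n p.1 p.2) := by
  rw [hB.span_unit n]
  exact hb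

theorem matrixAverage_mem_centralizer (hB : IsUHFSequence B k) (n : ℕ) (a : A) :
    matrixAverage (hB.unit n) a ∈ StarSubalgebra.centralizer ℂ (B n : Set A) := by
  rw [StarSubalgebra.mem_centralizer_iff]
  have key : ∀ b ∈ B n, ∀ a : A,
      b * matrixAverage (hB.unit n) a = matrixAverage (hB.unit n) a * b := by
    intro b hb a
    replace hb := hB.mem_span hb
    induction hb using Submodule.span_induction with
    | mem x hx =>
      obtain ⟨⟨p, q⟩, rfl⟩ := hx
      exact (hB.isMatrixUnits n).commute_matrixAverage p q a
    | zero => simp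
    | add x y _ _ hx hy => rw [add_mul, mul_add, hx, hy]
    | smul c x _ hx => rw [smul_mul_assoc, mul_smul_comm, hx]
  intro b hb
  exact ⟨key b hb a, key _ (star_mem hb) a⟩

theorem eq_of_isTracialState (hB : IsUHFSequence B k) {τ σ : StrongDual ℂ A}
    (hτ : IsTracialState (τ : A →ₗ[ℂ] ℂ)) (hσ : IsTracialState (σ : A →ₗ[ℂ] ℂ)) : τ = σ := by
  have h : Set.EqOn τ σ (⋃ n, (B n : Set A)) := by
    rintro b hb
    obtain ⟨n, hn⟩ := Set.mem_iUnion.mp hb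
    have := hB.nonempty_fin n
    obtain ⟨c, hc⟩ := (hB.isMatrixUnits n).matrixAverage_mem_span_one (hB.mem_span hn)
    have key : ∀ ρ : StrongDual ℂ A, IsTracialState (ρ : A →ₗ[ℂ] ℂ) → ρ b = c := by
      intro ρ hρ
      have h1 := (hB.isMatrixUnits n).apply_matrixAverage hρ.trace b
      rw [hc, map_smul, hρ.map_one] at h1
      simpa using h1.symm
    rw [key τ hτ, key σ hσ]
  exact DFunLike.coe_injective (Continuous.ext_on hB.dense τ.continuous σ.continuous h)

end IsUHFSequence

/-! ### The Kaplansky density theorem -/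

section Density

variable {H : Type*} [NormedAddCommGroup H] [InnerProductSpace ℂ H]

/-- A real subspace of a complex Hilbert space is dense at `z` as soon as every vector that is
real-orthogonal to the subspace is real-orthogonal to `z`. -/
theorem mem_closure_of_forall_re_inner [CompleteSpace H] (W : Submodule ℝ H) (z : H)
    (h : ∀ η : H, (∀ w ∈ W, (⟪η, w⟫_ℂ).re = 0) → (⟪η, z⟫_ℂ).re = 0) :
    z ∈ closure (W : Set H) := by
  let : InnerProductSpace ℝ H := InnerProductSpace.rclikeToReal ℂ H
  have h1 : z ∈ (Submodule.orthogonal (𝕜 := ℝ) (E := H) W)ᗮ := by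
    rw [Submodule.mem_orthogonal]
    intro η hη
    refine h η fun w hw => ?_
    have := (Submodule.mem_orthogonal' W η).mp hη w hw
    exact this
  rw [Submodule.orthogonal_orthogonal_eq_closure] at h1
  exact h1

/-- The diagonal amplification `T ⊕ ⋯ ⊕ T` of an operator. -/
noncomputable def diagonalOperator (ι : Type*) [Fintype ι] (T : H →L[ℂ] H) :
    PiLp 2 (fun _ : ι => H) →L[ℂ] PiLp 2 (fun _ : ι => H) :=
  ((PiLp.continuousLinearEquiv 2 ℂ (fun _ : ι => H)).symm.toContinuousLinearMap.comp
    (ContinuousLinearMap.pi fun i => T.comp (ContinuousLinearMap.proj i))).comp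
    (PiLp.continuousLinearEquiv 2 ℂ (fun _ : ι => H)).toContinuousLinearMap

@[simp]
theorem diagonalOperator_apply {ι : Type*} [Fintype ι] (T : H →L[ℂ] H)
    (y : PiLp 2 (fun _ : ι => H)) (i : ι) : diagonalOperator ι T y i = T (y i) := rfl

variable [CompleteSpace H]

/-- The von Neumann double commutant theorem: elements of the double commutant of a unital
*-algebra of operators are approximated by the algebra on finitely many vectors. -/
theorem exists_mem_norm_sub_lt_of_mem_centralizer_centralizer
    (S : StarSubalgebra ℂ (H →L[ℂ] H)) {x : H →L[ℂ] H}
    (hx : x ∈ Set.centralizer (Set.centralizer (S : Set (H →L[ℂ] H))))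
    {ι : Type*} [Fintype ι] (ξ : ι → H) {ε : ℝ} (hε : 0 < ε) :
    ∃ s ∈ S, ∀ i, ‖s (ξ i) - x (ξ i)‖ < ε := by
  classical
  let Ξ : PiLp 2 (fun _ : ι => H) := WithLp.toLp 2 ξ
  let L : (H →L[ℂ] H) →ₗ[ℂ] PiLp 2 (fun _ : ι => H) :=
    { toFun := fun T => diagonalOperator ι T Ξ
      map_add' := fun T T' => by ext i; simp
      map_smul' := fun c T => by ext i; simp }
  let V₀ : Submodule ℂ (PiLp 2 (fun _ : ι => H)) := (Subalgebra.toSubmodule S.toSubalgebra).map L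
  let V : Submodule ℂ (PiLp 2 (fun _ : ι => H)) := V₀.topologicalClosure
  have : V.HasOrthogonalProjection := by
    have : CompleteSpace V := V₀.isClosed_topologicalClosure.completeSpace_coe
    infer_instance
  have hdiag : ∀ s ∈ S, ∀ v ∈ V, diagonalOperator ι s v ∈ V := by
    intro s hs v hv
    have h1 : Set.MapsTo (diagonalOperator ι s) (V₀ : Set (PiLp 2 (fun _ : ι => H)))
        (V₀ : Set (PiLp 2 (fun _ : ι => H))) := by
      rintro _ ⟨t, ht, rfl⟩
      exact ⟨s * t, S.mul_mem hs ht, by ext i; simp [L]⟩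
    exact h1.closure (diagonalOperator ι s).continuous hv
  have hP : ∀ s ∈ S, ∀ y, V.starProjection (diagonalOperator ι s y)
      = diagonalOperator ι s (V.starProjection y) := by
    intro s hs y
    refine Submodule.eq_starProjection_of_mem_of_inner_eq_zero
      (hdiag s hs _ (V.starProjection_apply_mem y)) ?_
    intro v hv
    have h2 : ∀ u w : PiLp 2 (fun _ : ι => H), ⟪diagonalOperator ι s u, w⟫_ℂ
        = ⟪u, diagonalOperator ι (star s) w⟫_ℂ := by
      intro u w
      simp only [PiLp.inner_apply, diagonalOperator_apply]
      refine Finset.sum_congr rfl fun i _ => ?_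
      rw [ContinuousLinearMap.star_eq_adjoint, ContinuousLinearMap.adjoint_inner_right]
    rw [← map_sub, h2]
    exact Submodule.starProjection_inner_eq_zero y _ (hdiag _ (star_mem hs) v hv)
  -- The matrix entries of the projection onto `V` lie in the commutant of `S`.
  let Q : ι → ι → H →L[ℂ] H := fun i j =>
    (((ContinuousLinearMap.proj i).comp
      (PiLp.continuousLinearEquiv 2 ℂ (fun _ : ι => H)).toContinuousLinearMap).comp
      V.starProjection).comp
      ((PiLp.continuousLinearEquiv 2 ℂ (fun _ : ι => H)).symm.toContinuousLinearMap.comp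
        (ContinuousLinearMap.single ℂ (fun _ : ι => H) j))
  have hQ : ∀ i j h, Q i j h = V.starProjection (WithLp.toLp 2 (Pi.single j h)) i :=
    fun i j h => rfl
  have hsingle : ∀ (T : H →L[ℂ] H) (j : ι) (h : H),
      (WithLp.toLp 2 (Pi.single j (T h)) : PiLp 2 (fun _ : ι => H))
        = diagonalOperator ι T (WithLp.toLp 2 (Pi.single j h)) := by
    intro T j h
    ext i
    by_cases hij : i = j
    · subst hij; simp
    · simp [hij]
  have hQS : ∀ i j, Q i j ∈ Set.centralizer (S : Set (H →L[ℂ] H)) := by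
    intro i j s hs
    ext h
    simp only [mul_apply_eq_comp, hQ]
    rw [hsingle, hP s hs, diagonalOperator_apply]
  have hsum : ∀ (y : PiLp 2 (fun _ : ι => H)) i, V.starProjection y i = ∑ j, Q i j (y j) := by
    intro y i
    have hy : y = ∑ j, (WithLp.toLp 2 (Pi.single j (y j)) : PiLp 2 (fun _ : ι => H)) := by
      ext l
      simp [Finset.sum_apply, Pi.single_apply]
    conv_lhs => rw [hy]
    simp [hQ, WithLp.ofLp_sum]
  have hPx : ∀ y, V.starProjection (diagonalOperator ι x y)
      = diagonalOperator ι x (V.starProjection y) := by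
    intro y
    ext i
    rw [diagonalOperator_apply, hsum, hsum, map_sum]
    refine Finset.sum_congr rfl fun j _ => ?_
    have := hx (Q i j) (hQS i j)
    exact DFunLike.congr_fun this (y j)
  have hΞ : Ξ ∈ V := V₀.le_topologicalClosure ⟨1, S.one_mem, by ext i; simp [L]⟩
  have hxV : diagonalOperator ι x Ξ ∈ V := by
    rw [← Submodule.starProjection_eq_self_iff.mpr hΞ, ← hPx]
    exact V.starProjection_apply_mem _
  obtain ⟨_, ⟨s, hs, rfl⟩, hdist⟩ := Metric.mem_closure_iff.mp hxV ε hε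
  refine ⟨s, hs, fun i => ?_⟩
  rw [dist_comm, dist_eq_norm] at hdist
  refine lt_of_le_of_lt ?_ hdist
  exact PiLp.norm_apply_le (p := 2) (L s - diagonalOperator ι x Ξ) i

variable {A : Type*} [CStarAlgebra A] (π : A →⋆ₐ[ℂ] (H →L[ℂ] H))

theorem exists_isSelfAdjoint_norm_sub_lt {x : H →L[ℂ] H}
    (hx : x ∈ Set.centralizer (Set.centralizer (π.range : Set (H →L[ℂ] H))))
    (hxs : IsSelfAdjoint x)
    {ι : Type*} [Fintype ι] (ξ : ι → H) {ε : ℝ} (hε : 0 < ε) :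
    ∃ a : A, IsSelfAdjoint a ∧ ∀ i, ‖π a (ξ i) - x (ξ i)‖ < ε := by
  let Ξ : PiLp 2 (fun _ : ι => H) := WithLp.toLp 2 ξ
  let W : Submodule ℝ (PiLp 2 (fun _ : ι => H)) :=
    { carrier := {w | ∃ a : A, IsSelfAdjoint a ∧ w = diagonalOperator ι (π a) Ξ}
      add_mem' := by
        rintro _ _ ⟨a, ha, rfl⟩ ⟨b, hb, rfl⟩
        exact ⟨a + b, ha.add hb, by ext i; simp⟩
      zero_mem' := ⟨0, IsSelfAdjoint.zero A, by ext i; simp⟩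
      smul_mem' := by
        rintro c _ ⟨a, ha, rfl⟩
        refine ⟨(c : ℂ) • a, ?_, ?_⟩
        · rw [Complex.coe_smul]
          exact IsSelfAdjoint.smul (IsSelfAdjoint.all c) ha
        · rw [map_smul, Complex.coe_smul]
          ext i
          simp }
  have hcl : diagonalOperator ι x Ξ ∈ closure (W : Set (PiLp 2 (fun _ : ι => H))) := by
    refine mem_closure_of_forall_re_inner W _ fun η hη => ?_
    -- Approximate `x` on the vectors of both `Ξ` and `η` and take real parts.
    by_contra hne
    set t := (⟪η, diagonalOperator ι x Ξ⟫_ℂ).re with ht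
    let c : ℝ := ∑ i, (‖η i‖ + ‖ξ i‖) + 1
    have hc : 0 < c := by positivity
    obtain ⟨_, ⟨b, rfl⟩, hb⟩ := exists_mem_norm_sub_lt_of_mem_centralizer_centralizer π.range hx
      (Sum.elim ξ (fun i => η i)) (ε := |t| / c) (by positivity)
    have h1 := hη (diagonalOperator ι (π (b + star b)) Ξ) ⟨_, IsSelfAdjoint.add_star_self b, rfl⟩
    have h2 : ⟪η, diagonalOperator ι (π (b + star b)) Ξ⟫_ℂ - 2 * ⟪η, diagonalOperator ι x Ξ⟫_ℂ
        = ∑ i, (⟪η i, π b (ξ i) - x (ξ i)⟫_ℂ + ⟪π b (η i) - x (η i), ξ i⟫_ℂ) := by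
      simp only [PiLp.inner_apply, diagonalOperator_apply, Finset.mul_sum,
        ← Finset.sum_sub_distrib]
      refine Finset.sum_congr rfl fun i _ => ?_
      have e1 : ⟪x (η i), ξ i⟫_ℂ = ⟪η i, x (ξ i)⟫_ℂ := by
        conv_rhs => rw [← hxs.star_eq]
        rw [ContinuousLinearMap.star_eq_adjoint, ContinuousLinearMap.adjoint_inner_right]
      have e2 : ⟪η i, π (star b) (ξ i)⟫_ℂ = ⟪π b (η i), ξ i⟫_ℂ := by
        rw [map_star, ContinuousLinearMap.star_eq_adjoint,
          ContinuousLinearMap.adjoint_inner_right]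
      have e3 : (Ξ i) = ξ i := rfl
      simp only [e3, map_add, add_apply, inner_add_right, inner_sub_right,
        inner_sub_left, e1, e2]
      ring
    have h3 : ‖∑ i, (⟪η i, π b (ξ i) - x (ξ i)⟫_ℂ + ⟪π b (η i) - x (η i), ξ i⟫_ℂ)‖
        ≤ |t| / c * ∑ i, (‖η i‖ + ‖ξ i‖) := by
      rw [Finset.mul_sum]
      refine norm_sum_le_of_le _ fun i _ => ?_
      refine (norm_add_le _ _).trans ?_
      have e1 := (norm_inner_le_norm (𝕜 := ℂ) (η i) (π b (ξ i) - x (ξ i))).trans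
        (mul_le_mul_of_nonneg_left (hb (Sum.inl i)).le (norm_nonneg _))
      have e2 := (norm_inner_le_norm (𝕜 := ℂ) (π b (η i) - x (η i)) (ξ i)).trans
        (mul_le_mul_of_nonneg_right (hb (Sum.inr i)).le (norm_nonneg _))
      nlinarith
    have h4 : |t| / c * ∑ i, (‖η i‖ + ‖ξ i‖) ≤ |t| := by
      rw [div_mul_eq_mul_div, div_le_iff₀ hc]
      refine mul_le_mul_of_nonneg_left ?_ (abs_nonneg t)
      simp [c]
    have h5 := (Complex.abs_re_le_norm _).trans ((congrArg norm h2).le.trans (h3.trans h4))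
    rw [Complex.sub_re, h1] at h5
    have h6 : (2 * ⟪η, diagonalOperator ι x Ξ⟫_ℂ).re = 2 * t := by simp [ht]
    rw [h6, zero_sub, abs_neg, abs_mul, abs_two] at h5
    have : 0 < |t| := abs_pos.mpr hne
    linarith
  obtain ⟨_, ⟨a, ha, rfl⟩, hdist⟩ := Metric.mem_closure_iff.mp hcl ε hε
  refine ⟨a, ha, fun i => ?_⟩
  rw [dist_comm, dist_eq_norm] at hdist
  exact lt_of_le_of_lt
    (PiLp.norm_apply_le (p := 2) (diagonalOperator ι (π a) Ξ - diagonalOperator ι x Ξ) i) hdist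

/-- The resolvent formula that makes `t ↦ 2 t / (1 + t²)` strongly continuous on self-adjoint
operators: with `r t = 1 / (1 + t²)` one has
`f(a) - f(y) = 2 r(a) (a - y) r(y) + 2 a r(a) (y - a) y r(y)`. -/
theorem norm_cfc_apply_sub_le {a y : H →L[ℂ] H} (ha : IsSelfAdjoint a) (hy : IsSelfAdjoint y)
    (ξ : H) :
    ‖cfc (fun t : ℝ => 2 * t / (1 + t ^ 2)) a ξ - cfc (fun t : ℝ => 2 * t / (1 + t ^ 2)) y ξ‖
      ≤ 2 * ‖a (cfc (fun t : ℝ => (1 + t ^ 2)⁻¹) y ξ) - y (cfc (fun t : ℝ => (1 + t ^ 2)⁻¹) y ξ)‖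
        + 2 * ‖a (y (cfc (fun t : ℝ => (1 + t ^ 2)⁻¹) y ξ))
          - y (y (cfc (fun t : ℝ => (1 + t ^ 2)⁻¹) y ξ))‖ := by
  have hne : ∀ t : ℝ, 1 + t ^ 2 ≠ 0 := fun t => by positivity
  have hc : Continuous fun t : ℝ => (1 + t ^ 2)⁻¹ :=
    (by fun_prop : Continuous fun t : ℝ => 1 + t ^ 2).inv₀ hne
  have hfc : ∀ b : H →L[ℂ] H, IsSelfAdjoint b →
      cfc (fun t : ℝ => 2 * t / (1 + t ^ 2)) b
        = (2 : ℝ) • (b * cfc (fun t : ℝ => (1 + t ^ 2)⁻¹) b) := by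
    intro b hb
    have h1 : b * cfc (fun t : ℝ => (1 + t ^ 2)⁻¹) b
        = cfc (fun t : ℝ => t * (1 + t ^ 2)⁻¹) b := by
      rw [cfc_mul (fun t : ℝ => t) _ b (by fun_prop) hc.continuousOn, cfc_id' ℝ b]
    rw [h1, ← cfc_smul (2 : ℝ) (fun t : ℝ => t * (1 + t ^ 2)⁻¹) b
      (continuous_id.mul hc).continuousOn]
    congr 1
    ext t
    simp only [smul_eq_mul]
    ring
  have hcomm : ∀ b : H →L[ℂ] H, b * cfc (fun t : ℝ => (1 + t ^ 2)⁻¹) b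
      = cfc (fun t : ℝ => (1 + t ^ 2)⁻¹) b * b := fun b =>
    ((Commute.refl b).cfc_real _).eq.symm
  have hinv : ∀ b : H →L[ℂ] H, IsSelfAdjoint b →
      cfc (fun t : ℝ => (1 + t ^ 2)⁻¹) b * (1 + b * b) = 1 := by
    intro b hb
    have h1 : (1 + b * b) = cfc (fun t : ℝ => 1 + t ^ 2) b := by
      rw [cfc_add b (fun _ : ℝ => (1 : ℝ)) (fun t : ℝ => t ^ 2), cfc_const_one ℝ b,
        cfc_pow_id (R := ℝ) b 2, pow_two]
    rw [h1, ← cfc_mul _ _ b hc.continuousOn (by fun_prop), ← cfc_one ℝ b]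
    exact cfc_congr fun t _ => inv_mul_cancel₀ (hne t)
  set ra := cfc (fun t : ℝ => (1 + t ^ 2)⁻¹) a with hra
  set ry := cfc (fun t : ℝ => (1 + t ^ 2)⁻¹) y with hry
  have hn1 : ‖ra‖ ≤ 1 := norm_cfc_le zero_le_one fun t _ => by
    rw [norm_inv, Real.norm_of_nonneg (by positivity)]
    exact inv_le_one_of_one_le₀ (by nlinarith [sq_nonneg t])
  have hn2 : ‖a * ra‖ ≤ 1 := by
    rw [hra]
    nth_rw 1 [← cfc_id' ℝ a]
    rw [← cfc_mul _ _ a (by fun_prop) hc.continuousOn]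
    refine norm_cfc_le zero_le_one fun t _ => ?_
    rw [norm_mul, norm_inv, Real.norm_of_nonneg (by positivity : (0 : ℝ) ≤ 1 + t ^ 2),
      ← div_eq_mul_inv, div_le_one (by positivity), Real.norm_eq_abs]
    nlinarith [sq_nonneg (|t| - 1), sq_abs t, abs_nonneg t]
  have hia := hinv a ha
  have hiy : (1 + y * y) * ry = 1 := by
    have h1 := hinv y hy
    rw [mul_add, mul_one, ← mul_assoc, ← hcomm y, mul_assoc, ← hcomm y] at h1
    rw [add_mul, one_mul, mul_assoc]
    exact h1
  have key : a * ra - y * ry = ra * (a - y) * ry - a * ra * ((a - y) * (y * ry)) := by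
    calc a * ra - y * ry = a * ra * ((1 + y * y) * ry) - ra * (1 + a * a) * (y * ry) := by
          rw [hiy, hia, mul_one, one_mul]
      _ = ra * a * ((1 + y * y) * ry) - ra * (1 + a * a) * (y * ry) := by rw [hcomm a]
      _ = ra * (a - y) * ry - ra * a * ((a - y) * (y * ry)) := by noncomm_ring
      _ = _ := by rw [hcomm a]
  rw [hfc a ha, hfc y hy, ← sub_apply, ← smul_sub, key]
  have e : ((2 : ℝ) • (ra * (a - y) * ry - a * ra * ((a - y) * (y * ry)))) ξ
      = (2 : ℝ) • (ra (a (ry ξ) - y (ry ξ)) - (a * ra) (a (y (ry ξ)) - y (y (ry ξ)))) := by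
    simp
  rw [e, norm_smul, Real.norm_ofNat, ← mul_add]
  refine mul_le_mul_of_nonneg_left ((norm_sub_le _ _).trans (add_le_add ?_ ?_)) zero_le_two
  · exact (ra.le_of_opNorm_le hn1 _).trans_eq (one_mul _)
  · exact ((a * ra).le_of_opNorm_le hn2 _).trans_eq (one_mul _)

/-- The Kaplansky density theorem for self-adjoint elements. A self-adjoint contraction is
`f(y)` with `f t = 2 t / (1 + t²)` and `y = x / (1 + √(1 - x²))`; since `f` is bounded by `1` and
strongly continuous, `f(a)` approximates `x` when `a` approximates `y`. -/
theorem exists_isSelfAdjoint_norm_le_one_norm_sub_lt {x : H →L[ℂ] H}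
    (hx : x ∈ Set.centralizer (Set.centralizer (π.range : Set (H →L[ℂ] H))))
    (hxs : IsSelfAdjoint x) (hx1 : ‖x‖ ≤ 1)
    {ι : Type*} [Fintype ι] (ξ : ι → H) {ε : ℝ} (hε : 0 < ε) :
    ∃ a : A, ‖a‖ ≤ 1 ∧ ∀ i, ‖π a (ξ i) - x (ξ i)‖ < ε := by
  have hne : ∀ t : ℝ, 1 + t ^ 2 ≠ 0 := fun t => by positivity
  have hfcont : Continuous fun t : ℝ => 2 * t / (1 + t ^ 2) :=
    (by fun_prop : Continuous fun t : ℝ => 2 * t).div (by fun_prop) hne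
  have hgcont : Continuous fun t : ℝ => t / (1 + √(1 - t ^ 2)) :=
    continuous_id.div (by fun_prop) fun t => by positivity
  let y := cfc (fun t : ℝ => t / (1 + √(1 - t ^ 2))) x
  have hys : IsSelfAdjoint y := cfc_predicate _ x
  have hyx : cfc (fun t : ℝ => 2 * t / (1 + t ^ 2)) y = x := by
    rw [← cfc_comp' _ _ x hfcont.continuousOn hgcont.continuousOn]
    conv_rhs => rw [← cfc_id' ℝ x]
    refine cfc_congr fun t ht => ?_
    have ht1 : |t| ≤ 1 := (spectrum.norm_le_norm_mul_of_mem ht).trans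
      (mul_le_one₀ hx1 (norm_nonneg _) ContinuousLinearMap.norm_id_le)
    have h0 : 0 ≤ 1 - t ^ 2 := by nlinarith [sq_abs t, abs_nonneg t]
    have hs : √(1 - t ^ 2) ^ 2 = 1 - t ^ 2 := Real.sq_sqrt h0
    have hs0 : 0 ≤ √(1 - t ^ 2) := Real.sqrt_nonneg _
    set s := √(1 - t ^ 2)
    have h3 : 1 + (t / (1 + s)) ^ 2 = 2 / (1 + s) := by
      field_simp
      nlinarith
    simp only [h3]
    field_simp
  have hyM : y ∈ Set.centralizer (Set.centralizer (π.range : Set (H →L[ℂ] H))) := by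
    intro c hc
    have h1 : Commute x c := (hx c hc).symm
    exact (h1.cfc_real _).eq.symm
  let r := cfc (fun t : ℝ => (1 + t ^ 2)⁻¹) y
  obtain ⟨a, ha, hay⟩ := exists_isSelfAdjoint_norm_sub_lt π hyM hys
    (Sum.elim (fun i => r (ξ i)) (fun i => y (r (ξ i)))) (ε := ε / 4) (by positivity)
  refine ⟨cfc (fun t : ℝ => 2 * t / (1 + t ^ 2)) a,
    norm_cfc_le zero_le_one fun t _ => ?_, fun i => ?_⟩
  · rw [norm_div, Real.norm_of_nonneg (by positivity : (0 : ℝ) ≤ 1 + t ^ 2),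
      div_le_one (by positivity), Real.norm_eq_abs, abs_mul, abs_two]
    nlinarith [sq_nonneg (|t| - 1), sq_abs t, abs_nonneg t]
  · have hmap : π (cfc (fun t : ℝ => 2 * t / (1 + t ^ 2)) a)
        = cfc (fun t : ℝ => 2 * t / (1 + t ^ 2)) (π a) :=
      StarAlgHomClass.map_cfc π _ a hfcont.continuousOn
        (AddMonoidHomClass.continuous_of_bound π 1 fun a => by
          simpa only [one_mul] using NonUnitalStarAlgHom.norm_apply_le π a) ha (ha.map π)
    have h := norm_cfc_apply_sub_le (ha.map π) hys (ξ i)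
    rw [hyx, ← hmap] at h
    have h1 := hay (Sum.inl i)
    have h2 := hay (Sum.inr i)
    simp only [Sum.elim_inl, Sum.elim_inr] at h1 h2
    refine h.trans_lt ?_
    linarith

theorem exists_norm_le_norm_sub_lt {x : H →L[ℂ] H} (hx : x ∈ bicommutant π.range)
    {ι : Type*} [Fintype ι] (ξ : ι → H) {ε : ℝ} (hε : 0 < ε) :
    ∃ a : A, ‖a‖ ≤ 2 * ‖x‖ ∧ ∀ i, ‖π a (ξ i) - x (ξ i)‖ < ε := by
  have hsa : ∀ z ∈ bicommutant π.range, IsSelfAdjoint z → ∀ c : ℝ, 0 < c → ‖z‖ ≤ c →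
      ∀ δ : ℝ, 0 < δ → ∃ a : A, ‖a‖ ≤ c ∧ ∀ i, ‖π a (ξ i) - z (ξ i)‖ < δ := by
    intro z hz hzs c hc hzc δ hδ
    have hmem : (((c⁻¹ : ℝ) : ℂ) • z) ∈ bicommutant π.range :=
      (bicommutant π.range).toStarSubalgebra.smul_mem hz _
    rw [← SetLike.mem_coe, coe_bicommutant] at hmem
    rw [Complex.coe_smul] at hmem
    obtain ⟨a, ha, hax⟩ := exists_isSelfAdjoint_norm_le_one_norm_sub_lt π hmem
      (IsSelfAdjoint.smul (IsSelfAdjoint.all c⁻¹) hzs)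
      (by
        rw [norm_smul, norm_inv, Real.norm_of_nonneg hc.le, inv_mul_le_iff₀ hc, mul_one]
        exact hzc) ξ
      (ε := δ / c) (by positivity)
    refine ⟨(c : ℂ) • a, ?_, fun i => ?_⟩
    · rw [norm_smul, Complex.norm_real, Real.norm_of_nonneg hc.le]
      exact mul_le_of_le_one_right hc.le ha
    · have h1 : π ((c : ℂ) • a) (ξ i) - z (ξ i)
          = (c : ℂ) • (π a (ξ i) - (c⁻¹ • z) (ξ i)) := by
        rw [map_smul, smul_sub, Complex.coe_smul, Complex.coe_smul]
        simp [smul_smul, hc.ne']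
      rw [h1, norm_smul, Complex.norm_real, Real.norm_of_nonneg hc.le]
      have := hax i
      rwa [lt_div_iff₀' hc] at this
  rcases eq_or_ne x 0 with rfl | hx0
  · exact ⟨0, by simp, fun i => by simpa using hε⟩
  have hpos : 0 < ‖x‖ := norm_pos_iff.mpr hx0
  have hstar : star x ∈ bicommutant π.range := star_mem hx
  have hre : (realPart x : H →L[ℂ] H) ∈ bicommutant π.range := by
    rw [realPart_apply_coe, ← Complex.coe_smul]
    exact (bicommutant π.range).toStarSubalgebra.smul_mem
      ((bicommutant π.range).toStarSubalgebra.add_mem hx hstar) _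
  have him : (imaginaryPart x : H →L[ℂ] H) ∈ bicommutant π.range := by
    rw [imaginaryPart_apply_coe, ← Complex.coe_smul]
    exact (bicommutant π.range).toStarSubalgebra.smul_mem
      ((bicommutant π.range).toStarSubalgebra.smul_mem
        ((bicommutant π.range).toStarSubalgebra.sub_mem hx hstar) _) _
  obtain ⟨a, ha, hax⟩ := hsa _ hre (realPart x).2 ‖x‖ hpos (realPart.norm_le x) (ε / 2)
    (by positivity)
  obtain ⟨b, hb, hbx⟩ := hsa _ him (imaginaryPart x).2 ‖x‖ hpos (imaginaryPart.norm_le x) (ε / 2)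
    (by positivity)
  refine ⟨a + Complex.I • b, ?_, fun i => ?_⟩
  · refine (norm_add_le _ _).trans ?_
    rw [norm_smul, Complex.norm_I, one_mul]
    linarith
  · have h1 : π (a + Complex.I • b) (ξ i) - x (ξ i)
        = (π a (ξ i) - (realPart x : H →L[ℂ] H) (ξ i))
          + Complex.I • (π b (ξ i) - (imaginaryPart x : H →L[ℂ] H) (ξ i)) := by
      conv_lhs => rw [← realPart_add_I_smul_imaginaryPart x]
      simp only [map_add, map_smul, add_apply, smul_apply, smul_sub]
      abel
    rw [h1]
    refine (norm_add_le _ _).trans_lt ?_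
    rw [norm_smul, Complex.norm_I, one_mul]
    linarith [hax i, hbx i]

/-- The Kaplansky density theorem in terms of filters: every element of the von Neumann algebra
generated by `π` is the strong limit of a norm bounded family of elements of `π(A)`, with
preimages in `A` that are norm bounded as well. -/
theorem exists_filter_tendsto {x : H →L[ℂ] H} (hx : x ∈ bicommutant π.range) :
    ∃ l : Filter A, l.NeBot ∧ (∀ᶠ a in l, ‖a‖ ≤ 2 * ‖x‖) ∧
      ∀ ξ : H, Tendsto (fun a => π a ξ) l (𝓝 (x ξ)) := by
  classical
  have h : ∀ p : Finset H × ℕ, ∃ a : A, ‖a‖ ≤ 2 * ‖x‖ ∧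
      ∀ ξ ∈ p.1, ‖π a ξ - x ξ‖ < 1 / ((p.2 : ℝ) + 1) := by
    intro p
    obtain ⟨a, ha, hax⟩ := exists_norm_le_norm_sub_lt π hx (fun ξ : p.1 => (ξ : H))
      (ε := 1 / ((p.2 : ℝ) + 1)) (by positivity)
    exact ⟨a, ha, fun ξ hξ => hax ⟨ξ, hξ⟩⟩
  choose c hc hcx using h
  refine ⟨map c atTop, inferInstance, eventually_map.mpr (Eventually.of_forall hc), fun ξ => ?_⟩
  rw [tendsto_map'_iff, Metric.tendsto_atTop]
  intro ε hε
  obtain ⟨n, hn⟩ := exists_nat_one_div_lt hε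
  refine ⟨({ξ}, n), fun p hp => ?_⟩
  rw [dist_eq_norm]
  refine (hcx p ξ (hp.1 (Finset.mem_singleton_self ξ))).trans (lt_of_le_of_lt ?_ hn)
  have h2 : (n : ℝ) ≤ p.2 := by exact_mod_cast hp.2
  gcongr

end Density

/-! ### Averaged vector states -/

section Averaged

variable {H : Type*} [NormedAddCommGroup H] [InnerProductSpace ℂ H] {ι : Type*} [Fintype ι]

/-- The functional `x ↦ ⟪ξ, E(x) ξ⟫` on the bounded operators, where `E` is the average over the
matrix algebra with matrix units `e`. It is a finite sum of vector functionals. -/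
noncomputable def averagedVectorFunctional (e : ι → ι → (H →L[ℂ] H)) (ξ : H) :
    StrongDual ℂ (H →L[ℂ] H) :=
  (innerSL ℂ ξ).comp ((ContinuousLinearMap.apply ℂ H ξ).comp
    ⟨matrixAverage e, by
      change Continuous fun x : H →L[ℂ] H =>
        (Fintype.card ι : ℂ)⁻¹ • ∑ i, ∑ j, e i j * x * e j i
      fun_prop⟩)

theorem averagedVectorFunctional_apply (e : ι → ι → (H →L[ℂ] H)) (ξ : H) (x : H →L[ℂ] H) :
    averagedVectorFunctional e ξ x = ⟪ξ, matrixAverage e x ξ⟫_ℂ := rfl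

variable [CompleteSpace H] [DecidableEq ι] {e : ι → ι → (H →L[ℂ] H)}

theorem averagedVectorFunctional_eq_sum (he : IsMatrixUnits e) (ξ : H) (x : H →L[ℂ] H) :
    averagedVectorFunctional e ξ x
      = (Fintype.card ι : ℂ)⁻¹ * ∑ i, ∑ j, ⟪e j i ξ, x (e j i ξ)⟫_ℂ := by
  rw [averagedVectorFunctional_apply, matrixAverage_apply, smul_apply, inner_smul_right]
  simp only [sum_apply, mul_apply_eq_comp, inner_sum]
  congr 1
  refine Finset.sum_congr rfl fun i _ => Finset.sum_congr rfl fun j _ => ?_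
  rw [← he.star_eq j i, ContinuousLinearMap.star_eq_adjoint,
    ContinuousLinearMap.adjoint_inner_right]

theorem averagedVectorFunctional_nonneg (he : IsMatrixUnits e) (ξ : H) (x : H →L[ℂ] H) :
    0 ≤ averagedVectorFunctional e ξ (star x * x) := by
  rw [averagedVectorFunctional_eq_sum he]
  refine mul_nonneg (inv_nonneg.mpr (Nat.cast_nonneg _))
    (Finset.sum_nonneg fun i _ => Finset.sum_nonneg fun j _ => ?_)
  rw [mul_apply_eq_comp, ContinuousLinearMap.star_eq_adjoint,
    ContinuousLinearMap.adjoint_inner_right, inner_self_eq_norm_sq_to_K]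
  rw [← RCLike.ofReal_pow]
  exact RCLike.ofReal_nonneg.mpr (sq_nonneg _)

theorem averagedVectorFunctional_of_commute [Nonempty ι] (he : IsMatrixUnits e) (ξ : H)
    {x : H →L[ℂ] H} (hx : ∀ i j, e i j * x = x * e i j) :
    averagedVectorFunctional e ξ x = ⟪ξ, x ξ⟫_ℂ := by
  rw [averagedVectorFunctional_apply, he.matrixAverage_of_commute hx]

theorem norm_averagedVectorFunctional_le [Nonempty ι] (he : IsMatrixUnits e) {ξ : H}
    (hξ : ‖ξ‖ = 1) : ‖averagedVectorFunctional e ξ‖ ≤ 1 := by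
  refine ContinuousLinearMap.opNorm_le_bound _ zero_le_one fun x => ?_
  rw [averagedVectorFunctional_apply]
  refine (norm_inner_le_norm _ _).trans ?_
  have h := (matrixAverage e x).le_of_opNorm_le (he.norm_matrixAverage_le x) ξ
  rw [hξ, mul_one] at h
  rwa [hξ, one_mul, one_mul]

theorem averagedVectorFunctional_mul_comm (he : IsMatrixUnits e) (ξ : H) {b : H →L[ℂ] H}
    (hb : b ∈ Submodule.span ℂ (Set.range fun p : ι × ι => e p.1 p.2)) (x : H →L[ℂ] H) :
    averagedVectorFunctional e ξ (b * x) = averagedVectorFunctional e ξ (x * b) := by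
  induction hb using Submodule.span_induction with
  | mem y hy =>
    obtain ⟨⟨p, q⟩, rfl⟩ := hy
    rw [averagedVectorFunctional_apply, he.matrixAverage_mul_comm]
    rfl
  | zero => simp
  | add y z _ _ hy hz => rw [add_mul, mul_add, map_add, map_add, hy, hz]
  | smul c y _ hy => rw [smul_mul_assoc, mul_smul_comm, map_smul, map_smul, hy]

theorem tendsto_averagedVectorFunctional (he : IsMatrixUnits e) (ξ : H) {α : Type*}
    {l : Filter α} {z : α → H →L[ℂ] H} {z₀ : H →L[ℂ] H}
    (hz : ∀ η : H, Tendsto (fun a => ⟪η, z a η⟫_ℂ) l (𝓝 ⟪η, z₀ η⟫_ℂ)) :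
    Tendsto (fun a => averagedVectorFunctional e ξ (z a)) l
      (𝓝 (averagedVectorFunctional e ξ z₀)) := by
  simp only [averagedVectorFunctional_eq_sum he]
  exact tendsto_const_nhds.mul (tendsto_finsetSum _ fun i _ => tendsto_finsetSum _ fun j _ => hz _)

end Averaged

/-! ### Limits along ultrafilters -/

theorem exists_ultrafilter_limit_strongDual {E α : Type*} [SeminormedAddCommGroup E]
    [NormedSpace ℂ E] (𝒰 : Ultrafilter α) {f : α → StrongDual ℂ E} {c : ℝ}
    (hf : ∀ a, ‖f a‖ ≤ c) :
    ∃ T : StrongDual ℂ E, ∀ x, Tendsto (fun a => f a x) 𝒰 (𝓝 (T x)) := by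
  have hK := WeakDual.isCompact_closedBall (𝕜 := ℂ) (E := E) 0 c
  obtain ⟨T, -, hT⟩ := hK.ultrafilter_le_nhds (𝒰.map fun a => StrongDual.toWeakDual (f a)) (by
    rw [le_principal_iff, Ultrafilter.coe_map, mem_map]
    refine Filter.univ_mem' fun a => ?_
    simpa using hf a)
  refine ⟨WeakDual.toStrongDual T, fun x => ?_⟩
  exact ((WeakDual.eval_continuous x).tendsto T).comp hT

/-- Compactness of balls of operators in the weak operator topology, along an ultrafilter. -/
theorem exists_ultrafilter_limit_operator {H α : Type*} [NormedAddCommGroup H]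
    [InnerProductSpace ℂ H] [CompleteSpace H] (𝒰 : Ultrafilter α) {f : α → H →L[ℂ] H} {c : ℝ}
    (hc : 0 ≤ c) (hf : ∀ a, ‖f a‖ ≤ c) :
    ∃ y : H →L[ℂ] H, ‖y‖ ≤ c ∧ ∀ v w, Tendsto (fun a => ⟪w, f a v⟫_ℂ) 𝒰 (𝓝 ⟪w, y v⟫_ℂ) := by
  have hbd : ∀ v w a, ‖⟪f a v, w⟫_ℂ‖ ≤ c * ‖v‖ * ‖w‖ := fun v w a =>
    (norm_inner_le_norm _ _).trans
      (mul_le_mul_of_nonneg_right ((f a).le_of_opNorm_le (hf a) v) (norm_nonneg _))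
  have hlim : ∀ v w, ∃ g : ℂ, ‖g‖ ≤ c * ‖v‖ * ‖w‖ ∧
      Tendsto (fun a => ⟪f a v, w⟫_ℂ) 𝒰 (𝓝 g) := by
    intro v w
    obtain ⟨g, hg, h⟩ := (isCompact_closedBall (0 : ℂ) (c * ‖v‖ * ‖w‖)).ultrafilter_le_nhds
      (𝒰.map fun a => ⟪f a v, w⟫_ℂ) (by
        rw [le_principal_iff, Ultrafilter.coe_map, mem_map]
        exact Filter.univ_mem' fun a => by simpa using hbd v w a)
    exact ⟨g, by simpa using hg, h⟩
  choose g hg hgt using hlim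
  let L : H →ₗ⋆[ℂ] H →ₗ[ℂ] ℂ := LinearMap.mk₂'ₛₗ (starRingEnd ℂ) (RingHom.id ℂ) g
    (fun u v w => tendsto_nhds_unique (hgt (u + v) w) <| by
      simpa only [map_add, inner_add_left] using (hgt u w).add (hgt v w))
    (fun a v w => tendsto_nhds_unique (hgt (a • v) w) <| by
      simpa only [map_smul, inner_smul_left, smul_eq_mul] using
        (hgt v w).const_mul (starRingEnd ℂ a))
    (fun v w w' => tendsto_nhds_unique (hgt v (w + w')) <| by
      simpa only [inner_add_right] using (hgt v w).add (hgt v w'))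
    (fun a v w => tendsto_nhds_unique (hgt v (a • w)) <| by
      simpa only [inner_smul_right, smul_eq_mul, RingHom.id_apply] using (hgt v w).const_mul a)
  let L' : H →L⋆[ℂ] H →L[ℂ] ℂ := L.mkContinuous₂ c hg
  let y := InnerProductSpace.continuousLinearMapOfBilin L'
  have hy : ∀ v w, ⟪y v, w⟫_ℂ = g v w := fun v w =>
    InnerProductSpace.continuousLinearMapOfBilin_apply L' v w
  refine ⟨y, ContinuousLinearMap.opNorm_le_bound _ hc fun v => ?_, fun v w => ?_⟩
  · have h := hg v (y v)
    rw [← hy, inner_self_eq_norm_sq_to_K, norm_pow, RCLike.norm_ofReal, abs_norm] at h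
    rcases (norm_nonneg (y v)).eq_or_lt with h0 | h0
    · rw [← h0]; positivity
    · rw [pow_two] at h
      exact le_of_mul_le_mul_right h h0
  · have h := (Complex.continuous_conj.tendsto _).comp (hgt v w)
    rw [← hy] at h
    simpa only [Function.comp_def, inner_conj_symm] using h

/-! ### Norms of restricted functionals -/

section Restrict

variable {A : Type*} [CStarAlgebra A]

theorem restrictNorm_nonneg (f : StrongDual ℂ A) (C : StarSubalgebra ℂ A) :
    0 ≤ restrictNorm f C :=
  norm_nonneg (f.comp (Subalgebra.toSubmodule C.toSubalgebra).subtypeL)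

theorem norm_apply_le_restrictNorm (f : StrongDual ℂ A) {C : StarSubalgebra ℂ A} {c : A}
    (hc : c ∈ C) : ‖f c‖ ≤ restrictNorm f C * ‖c‖ :=
  (f.comp (Subalgebra.toSubmodule C.toSubalgebra).subtypeL).le_opNorm ⟨c, hc⟩

theorem exists_lt_norm_apply_of_lt_restrictNorm (f : StrongDual ℂ A) (C : StarSubalgebra ℂ A)
    {r : ℝ} (hr : r < restrictNorm f C) : ∃ c ∈ C, ‖c‖ ≤ 1 ∧ r < ‖f c‖ := by
  obtain ⟨x, hx, h⟩ := ContinuousLinearMap.exists_lt_apply_of_lt_opNorm _ hr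
  exact ⟨x, x.2, hx.le, h⟩

theorem restrictNorm_le_add (f g : StrongDual ℂ A) (C : StarSubalgebra ℂ A) :
    restrictNorm f C ≤ restrictNorm g C + ‖f - g‖ := by
  refine ContinuousLinearMap.opNorm_le_bound _
    (add_nonneg (restrictNorm_nonneg g C) (norm_nonneg _)) fun c => ?_
  have h1 := norm_apply_le_restrictNorm g c.2
  have h2 := (f - g).le_opNorm (c : A)
  have h3 : f c = g c + (f - g) c := by simp
  calc ‖f c‖ ≤ ‖g c‖ + ‖(f - g) c‖ := by rw [h3]; exact norm_add_le _ _
    _ ≤ (restrictNorm g C + ‖f - g‖) * ‖(c : A)‖ := by rw [add_mul]; exact add_le_add h1 h2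

variable {H : Type*} [NormedAddCommGroup H] [InnerProductSpace ℂ H] [CompleteSpace H]
  (π : A →⋆ₐ[ℂ] (H →L[ℂ] H))

theorem norm_vectorFunctional_sub_le {ξ η : H} (hξ : ‖ξ‖ = 1) (hη : ‖η‖ = 1) :
    ‖vectorFunctional π ξ - vectorFunctional π η‖ ≤ 2 * ‖ξ - η‖ := by
  refine ContinuousLinearMap.opNorm_le_bound _ (by positivity) fun a => ?_
  have h : (vectorFunctional π ξ - vectorFunctional π η) a
      = ⟪ξ - η, π a ξ⟫_ℂ + ⟪η, π a (ξ - η)⟫_ℂ := by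
    rw [sub_apply, vectorFunctional_apply, vectorFunctional_apply, map_sub, inner_sub_left,
      inner_sub_right]
    ring
  have hπ : ‖π a‖ ≤ ‖a‖ := NonUnitalStarAlgHom.norm_apply_le π a
  have h1 := (π a).le_of_opNorm_le hπ ξ
  have h2 := (π a).le_of_opNorm_le hπ (ξ - η)
  rw [hξ, mul_one] at h1
  rw [h]
  calc _ ≤ ‖ξ - η‖ * ‖π a ξ‖ + ‖η‖ * ‖π a (ξ - η)‖ :=
        (norm_add_le _ _).trans (add_le_add (norm_inner_le_norm _ _) (norm_inner_le_norm _ _))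
    _ ≤ ‖ξ - η‖ * ‖a‖ + 1 * (‖a‖ * ‖ξ - η‖) := by rw [hη]; gcongr
    _ = _ := by ring

end Restrict

/-- The Cauchy–Schwarz inequality for a positive functional, in the degenerate case. -/
theorem apply_mul_eq_zero_of_apply_star_mul_self_eq_zero {R : Type*} [Ring R] [StarRing R]
    [Algebra ℂ R] [StarModule ℂ R] {f : R →ₗ[ℂ] ℂ} (hf : ∀ a, 0 ≤ f (star a * a)) {x : R}
    (hx : f (star x * x) = 0) (b : R) : f (b * x) = 0 := by
  have h : ∀ t : ℂ, 0 ≤ f (b * star b) + t * f (b * x)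
      + starRingEnd ℂ t * f (star x * star b) := by
    intro t
    have h1 := hf (star b + t • x)
    have h2 : star (star b + t • x) * (star b + t • x) = b * star b + t • (b * x)
        + starRingEnd ℂ t • (star x * star b) + (starRingEnd ℂ t * t) • (star x * x) := by
      simp only [star_add, star_star, star_smul, add_mul, mul_add, smul_mul_assoc,
        mul_smul_comm, ← Complex.star_def]
      rw [smul_add, smul_smul, mul_comm t]
      abel
    rw [h2] at h1
    simpa only [map_add, map_smul, smul_eq_mul, hx, mul_zero, add_zero] using h1
  set p := f (b * x)
  set q := f (star x * star b)
  set c := f (b * star b)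
  have hc := (Complex.le_def.mp (h 0)).2
  have e1 := (Complex.le_def.mp (h 1)).2
  have e2 := (Complex.le_def.mp (h Complex.I)).2
  simp at hc e1 e2
  have hq : q = starRingEnd ℂ p := by
    apply Complex.ext
    · simp; linarith
    · simp; linarith
  have h3 : ∀ s : ℝ, 0 ≤ c.re - 2 * s * Complex.normSq p := by
    intro s
    have := (Complex.le_def.mp (h (-(s : ℂ) * starRingEnd ℂ p))).1
    rw [hq] at this
    simp [Complex.normSq_apply] at this ⊢
    linarith
  by_contra hp
  have hpos : 0 < Complex.normSq p := Complex.normSq_pos.mpr hp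
  have h4 := h3 ((c.re + 1) / (2 * Complex.normSq p))
  have h5 : 2 * ((c.re + 1) / (2 * Complex.normSq p)) * Complex.normSq p = c.re + 1 := by
    field_simp
  linarith

/-! ### The trace obtained as a limit of averaged vector states -/

section Main

variable {A : Type*} [CStarAlgebra A] {H : Type*} [NormedAddCommGroup H] [InnerProductSpace ℂ H]
  [CompleteSpace H] {B : ℕ → StarSubalgebra ℂ A} {k : ℕ → ℕ}

theorem apply_mem_bicommutant (π : A →⋆ₐ[ℂ] (H →L[ℂ] H)) (a : A) : π a ∈ bicommutant π.range := by
  rw [← SetLike.mem_coe, coe_bicommutant]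
  exact Set.subset_centralizer_centralizer ⟨a, rfl⟩

theorem continuous_starAlgHom (π : A →⋆ₐ[ℂ] (H →L[ℂ] H)) : Continuous π :=
  AddMonoidHomClass.continuous_of_bound π 1 fun a => by
    simpa only [one_mul] using NonUnitalStarAlgHom.norm_apply_le π a

namespace IsUHFSequence

theorem isMatrixUnits_map (hB : IsUHFSequence B k) (π : A →⋆ₐ[ℂ] (H →L[ℂ] H)) (n : ℕ) :
    IsMatrixUnits (fun i j => π (hB.unit n i j)) :=
  (hB.isMatrixUnits n).map π

/-- The vector state of `ξ` averaged over the image of the `n`-th matrix algebra. -/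
noncomputable def averagedState (hB : IsUHFSequence B k) (π : A →⋆ₐ[ℂ] (H →L[ℂ] H)) (ξ : H)
    (n : ℕ) : StrongDual ℂ (H →L[ℂ] H) :=
  averagedVectorFunctional (fun i j => π (hB.unit n i j)) ξ

theorem norm_averagedState_le (hB : IsUHFSequence B k) (π : A →⋆ₐ[ℂ] (H →L[ℂ] H)) {ξ : H}
    (hξ : ‖ξ‖ = 1) (n : ℕ) : ‖hB.averagedState π ξ n‖ ≤ 1 := by
  have := hB.nonempty_fin n
  exact norm_averagedVectorFunctional_le (hB.isMatrixUnits_map π n) hξ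

theorem averagedState_one (hB : IsUHFSequence B k) (π : A →⋆ₐ[ℂ] (H →L[ℂ] H)) {ξ : H}
    (hξ : ‖ξ‖ = 1) (n : ℕ) : hB.averagedState π ξ n 1 = 1 := by
  have := hB.nonempty_fin n
  rw [averagedState, averagedVectorFunctional_of_commute (hB.isMatrixUnits_map π n) ξ (by simp),
    one_apply_eq_self, inner_self_eq_norm_sq_to_K, hξ]
  simp

theorem averagedState_mul_comm (hB : IsUHFSequence B k) (π : A →⋆ₐ[ℂ] (H →L[ℂ] H)) (ξ : H)
    {n : ℕ} {b : A} (hb : b ∈ B n) (x : H →L[ℂ] H) :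
    hB.averagedState π ξ n (π b * x) = hB.averagedState π ξ n (x * π b) := by
  refine averagedVectorFunctional_mul_comm (hB.isMatrixUnits_map π n) ξ ?_ x
  have h := Submodule.mem_map_of_mem (f := π.toAlgHom.toLinearMap) (hB.mem_span hb)
  rw [Submodule.map_span, ← Set.range_comp] at h
  exact h

/-- A limit, along a free ultrafilter, of the averaged vector states. It is defined on all bounded
operators and tracial with respect to multiplication by elements of `π(A)`. -/
theorem exists_limit_averagedState (hB : IsUHFSequence B k) (π : A →⋆ₐ[ℂ] (H →L[ℂ] H)) {ξ : H}
    (hξ : ‖ξ‖ = 1) :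
    ∃ T : StrongDual ℂ (H →L[ℂ] H),
      (∀ x, Tendsto (fun n => hB.averagedState π ξ n x) (hyperfilter ℕ) (𝓝 (T x))) ∧
      T 1 = 1 ∧ (∀ x, 0 ≤ T (star x * x)) ∧ ∀ a x, T (π a * x) = T (x * π a) := by
  obtain ⟨T, hT⟩ := exists_ultrafilter_limit_strongDual (hyperfilter ℕ)
    (hB.norm_averagedState_le π hξ)
  refine ⟨T, hT, ?_, fun x => ?_, fun a x => ?_⟩
  · refine tendsto_nhds_unique (hT 1) ?_
    simp only [hB.averagedState_one π hξ]
    exact tendsto_const_nhds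
  · exact ge_of_tendsto' (hT _) fun n =>
      averagedVectorFunctional_nonneg (hB.isMatrixUnits_map π n) ξ x
  · have hπ : Continuous π := continuous_starAlgHom π
    have hcl : IsClosed {a : A | T (π a * x) = T (x * π a)} :=
      isClosed_eq (by fun_prop) (by fun_prop)
    have hsub : (⋃ n, (B n : Set A)) ⊆ {a : A | T (π a * x) = T (x * π a)} := by
      rintro b hb
      obtain ⟨m, hm⟩ := Set.mem_iUnion.mp hb
      refine tendsto_nhds_unique (hT _) ((hT _).congr' ?_)
      have h : ∀ᶠ n in atTop, hB.averagedState π ξ n (x * π b)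
          = hB.averagedState π ξ n (π b * x) := by
        filter_upwards [eventually_ge_atTop m] with n hn
        exact (hB.averagedState_mul_comm π ξ (hB.mono hn hm) x).symm
      exact h.filter_mono Nat.hyperfilter_le_atTop
    have := closure_minimal hsub hcl (hB.dense a)
    exact this

theorem exists_isTracialState (hB : IsUHFSequence B k) (π : A →⋆ₐ[ℂ] (H →L[ℂ] H)) {ξ : H}
    (hξ : ‖ξ‖ = 1) : ∃ τ : StrongDual ℂ A, IsTracialState (τ : A →ₗ[ℂ] ℂ) := by
  obtain ⟨T, -, h1, h2, h3⟩ := hB.exists_limit_averagedState π hξ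
  refine ⟨T.comp ⟨π.toAlgHom.toLinearMap, continuous_starAlgHom π⟩, ?_, fun a => ?_,
    fun a b => ?_⟩
  · change T (π 1) = 1
    rw [map_one, h1]
  · change 0 ≤ T (π (star a * a))
    rw [map_mul, map_star]
    exact h2 _
  · change T (π (a * b)) = T (π (b * a))
    rw [map_mul π, map_mul π, h3]

theorem norm_averagedState_sub_le (hB : IsUHFSequence B k) (π : A →⋆ₐ[ℂ] (H →L[ℂ] H)) (ξ : H)
    {τ : StrongDual ℂ A} (hτ : IsTracialState (τ : A →ₗ[ℂ] ℂ)) (n : ℕ) (a : A) :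
    ‖hB.averagedState π ξ n (π a) - τ a‖
      ≤ restrictNorm (τ - vectorFunctional π ξ) (StarSubalgebra.centralizer ℂ (B n : Set A))
        * ‖a‖ := by
  have := hB.nonempty_fin n
  have h1 : hB.averagedState π ξ n (π a)
      = vectorFunctional π ξ (matrixAverage (hB.unit n) a) := by
    rw [averagedState, averagedVectorFunctional_apply, ← map_matrixAverage,
      vectorFunctional_apply]
  have h2 : τ a = τ (matrixAverage (hB.unit n) a) :=
    ((hB.isMatrixUnits n).apply_matrixAverage hτ.trace a).symm
  rw [h1, h2, norm_sub_rev, ← sub_apply]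
  refine (norm_apply_le_restrictNorm _ (hB.matrixAverage_mem_centralizer n a)).trans ?_
  exact mul_le_mul_of_nonneg_left ((hB.isMatrixUnits n).norm_matrixAverage_le a)
    (restrictNorm_nonneg _ _)

theorem tendsto_averagedState (hB : IsUHFSequence B k) (π : A →⋆ₐ[ℂ] (H →L[ℂ] H)) (ξ : H)
    (n : ℕ) {α : Type*} {l : Filter α} {z : α → H →L[ℂ] H} {z₀ : H →L[ℂ] H}
    (hz : ∀ η : H, Tendsto (fun a => ⟪η, z a η⟫_ℂ) l (𝓝 ⟪η, z₀ η⟫_ℂ)) :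
    Tendsto (fun a => hB.averagedState π ξ n (z a)) l (𝓝 (hB.averagedState π ξ n z₀)) :=
  tendsto_averagedVectorFunctional (hB.isMatrixUnits_map π n) ξ hz

/-- Two averaged vector states that are both close to the trace on `A` are close to each other on
the generated von Neumann algebra, by the Kaplansky density theorem. -/
theorem norm_averagedState_sub_averagedState_le (hB : IsUHFSequence B k)
    (π : A →⋆ₐ[ℂ] (H →L[ℂ] H)) (ξ η : H)
    {τ : StrongDual ℂ A} (hτ : IsTracialState (τ : A →ₗ[ℂ] ℂ)) (n m : ℕ)
    {x : H →L[ℂ] H} (hx : x ∈ bicommutant π.range) :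
    ‖hB.averagedState π ξ n x - hB.averagedState π η m x‖
      ≤ (restrictNorm (τ - vectorFunctional π ξ) (StarSubalgebra.centralizer ℂ (B n : Set A))
        + restrictNorm (τ - vectorFunctional π η) (StarSubalgebra.centralizer ℂ (B m : Set A)))
        * (2 * ‖x‖) := by
  obtain ⟨l, hl, hbd, hlim⟩ := exists_filter_tendsto π hx
  have hin : ∀ v : H, Tendsto (fun a => ⟪v, π a v⟫_ℂ) l (𝓝 ⟪v, x v⟫_ℂ) := fun v =>
    tendsto_const_nhds.inner (hlim v)
  refine le_of_tendsto ((hB.tendsto_averagedState π ξ n hin).sub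
    (hB.tendsto_averagedState π η m hin)).norm ?_
  filter_upwards [hbd] with a ha
  have h1 := hB.norm_averagedState_sub_le π ξ hτ n a
  have h2 := hB.norm_averagedState_sub_le π η hτ m a
  have h3 : hB.averagedState π ξ n (π a) - hB.averagedState π η m (π a)
      = (hB.averagedState π ξ n (π a) - τ a) - (hB.averagedState π η m (π a) - τ a) := by ring
  rw [h3]
  refine (norm_sub_le _ _).trans ((add_le_add h1 h2).trans ?_)
  rw [← add_mul]
  exact mul_le_mul_of_nonneg_left ha (add_nonneg (restrictNorm_nonneg _ _)
    (restrictNorm_nonneg _ _))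

end IsUHFSequence

/-- The functional `T` is, on the von Neumann algebra generated by `π(A)`, approximated by the
averages of every vector state, up to an error controlled by the distance of that vector state to
`τ` on the relative commutants. -/
def IsLimitOfAverages (hB : IsUHFSequence B k) (π : A →⋆ₐ[ℂ] (H →L[ℂ] H)) (τ : StrongDual ℂ A)
    (T : StrongDual ℂ (H →L[ℂ] H)) : Prop :=
  ∀ ξ : H, ∀ n, ∀ x ∈ bicommutant π.range, ‖T x - hB.averagedState π ξ n x‖
    ≤ restrictNorm (τ - vectorFunctional π ξ) (StarSubalgebra.centralizer ℂ (B n : Set A))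
      * (2 * ‖x‖)

/-- The trace on the von Neumann algebra generated by `π(A)`: a functional that is the limit on
it of the averages of every vector state, with the rate of convergence given by the distance of
the trace and the vector state on the relative commutants. -/
theorem exists_trace_on_bicommutant (hB : IsUHFSequence B k) (π : A →⋆ₐ[ℂ] (H →L[ℂ] H))
    {τ : StrongDual ℂ A} (hτ : IsTracialState (τ : A →ₗ[ℂ] ℂ)) {ζ : H} (hζ : ‖ζ‖ = 1)
    (hconv : Tendsto (fun n => restrictNorm (τ - vectorFunctional π ζ)
      (StarSubalgebra.centralizer ℂ (B n : Set A))) atTop (𝓝 0)) :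
    ∃ T : StrongDual ℂ (H →L[ℂ] H), T 1 = 1 ∧ (∀ x, 0 ≤ T (star x * x)) ∧
      (∀ a x, T (π a * x) = T (x * π a)) ∧
      IsLimitOfAverages hB π τ T := by
  obtain ⟨T, hT, h1, h2, h3⟩ := hB.exists_limit_averagedState π hζ
  refine ⟨T, h1, h2, h3, fun ξ n x hx => ?_⟩
  refine le_of_tendsto_of_tendsto' ((hT x).sub_const _).norm ?_
    fun m => hB.norm_averagedState_sub_averagedState_le π ζ ξ hτ m n hx
  have h := ((hconv.mono_left Nat.hyperfilter_le_atTop).add_const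
    (restrictNorm (τ - vectorFunctional π ξ)
      (StarSubalgebra.centralizer ℂ (B n : Set A)))).mul_const (2 * ‖x‖)
  rwa [zero_add] at h

section Trace

variable (hB : IsUHFSequence B k) (π : A →⋆ₐ[ℂ] (H →L[ℂ] H)) {τ : StrongDual ℂ A}
  {T : StrongDual ℂ (H →L[ℂ] H)}

/-- The trace is continuous along bounded weakly convergent families. -/
theorem tendsto_trace (hT : IsLimitOfAverages hB π τ T) {ζ : H}
    (hconv : Tendsto (fun n => restrictNorm (τ - vectorFunctional π ζ)
      (StarSubalgebra.centralizer ℂ (B n : Set A))) atTop (𝓝 0))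
    {α : Type*} {l : Filter α} {z : α → H →L[ℂ] H} {z₀ : H →L[ℂ] H}
    (hz₀ : z₀ ∈ bicommutant π.range) {C : ℝ}
    (hz : ∀ᶠ a in l, z a ∈ bicommutant π.range ∧ ‖z a‖ ≤ C)
    (hlim : ∀ η : H, Tendsto (fun a => ⟪η, z a η⟫_ℂ) l (𝓝 ⟪η, z₀ η⟫_ℂ)) :
    Tendsto (fun a => T (z a)) l (𝓝 (T z₀)) := by
  rw [Metric.tendsto_nhds]
  intro δ hδ
  let M : ℝ := 2 * |C| + 2 * ‖z₀‖ + 1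
  have hM : 0 < M := by positivity
  obtain ⟨n, hn⟩ := (hconv.eventually_lt_const (show (0 : ℝ) < δ / 2 / M by positivity)).exists
  set ε := restrictNorm (τ - vectorFunctional π ζ) (StarSubalgebra.centralizer ℂ (B n : Set A))
    with hε
  have hε0 : 0 ≤ ε := restrictNorm_nonneg _ _
  have hεM : ε * M < δ / 2 := by rwa [lt_div_iff₀ hM] at hn
  have hev := (Metric.tendsto_nhds.mp (hB.tendsto_averagedState π ζ n hlim)) (δ / 2)
    (by positivity)
  filter_upwards [hz, hev] with a ha hd
  rw [dist_eq_norm] at hd ⊢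
  have h1 := hT ζ n _ ha.1
  have h2 := hT ζ n _ hz₀
  rw [← hε] at h1 h2
  have h3 : T (z a) - T z₀ = (T (z a) - hB.averagedState π ζ n (z a))
      + (hB.averagedState π ζ n (z a) - hB.averagedState π ζ n z₀)
      - (T z₀ - hB.averagedState π ζ n z₀) := by ring
  have h4 : ε * (2 * ‖z a‖) + ε * (2 * ‖z₀‖) ≤ ε * M := by
    rw [← mul_add]
    refine mul_le_mul_of_nonneg_left ?_ hε0
    have := ha.2.trans (le_abs_self C)
    simp only [M]
    linarith
  rw [h3]
  have h5 := norm_sub_le ((T (z a) - hB.averagedState π ζ n (z a))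
      + (hB.averagedState π ζ n (z a) - hB.averagedState π ζ n z₀))
      (T z₀ - hB.averagedState π ζ n z₀)
  have h6 := norm_add_le (T (z a) - hB.averagedState π ζ n (z a))
      (hB.averagedState π ζ n (z a) - hB.averagedState π ζ n z₀)
  linarith

theorem trace_mul_comm (hT : IsLimitOfAverages hB π τ T) {ζ : H}
    (hconv : Tendsto (fun n => restrictNorm (τ - vectorFunctional π ζ)
      (StarSubalgebra.centralizer ℂ (B n : Set A))) atTop (𝓝 0))
    (hTA : ∀ a x, T (π a * x) = T (x * π a))
    {x y : H →L[ℂ] H} (hx : x ∈ bicommutant π.range) (hy : y ∈ bicommutant π.range) :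
    T (x * y) = T (y * x) := by
  obtain ⟨l, hl, hbd, hlim⟩ := exists_filter_tendsto π hx
  have hmul := fun {u v : H →L[ℂ] H} (hu : u ∈ bicommutant π.range)
    (hv : v ∈ bicommutant π.range) => (bicommutant π.range).toStarSubalgebra.mul_mem hu hv
  have hπa : ∀ a, ‖π a‖ ≤ ‖a‖ := fun a => NonUnitalStarAlgHom.norm_apply_le π a
  have h1 : Tendsto (fun a => T (π a * y)) l (𝓝 (T (x * y))) := by
    refine tendsto_trace hB π hT hconv (hmul hx hy) (C := 2 * ‖x‖ * ‖y‖) ?_ fun η => ?_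
    · filter_upwards [hbd] with a ha
      refine ⟨hmul (apply_mem_bicommutant π a) hy, (norm_mul_le _ _).trans ?_⟩
      exact mul_le_mul_of_nonneg_right ((hπa a).trans ha) (norm_nonneg _)
    · exact tendsto_const_nhds.inner (hlim (y η))
  have h2 : Tendsto (fun a => T (y * π a)) l (𝓝 (T (y * x))) := by
    refine tendsto_trace hB π hT hconv (hmul hy hx) (C := ‖y‖ * (2 * ‖x‖)) ?_ fun η => ?_
    · filter_upwards [hbd] with a ha
      refine ⟨hmul hy (apply_mem_bicommutant π a), (norm_mul_le _ _).trans ?_⟩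
      exact mul_le_mul_of_nonneg_left ((hπa a).trans ha) (norm_nonneg _)
    · exact tendsto_const_nhds.inner ((y.continuous.tendsto _).comp (hlim η))
  refine tendsto_nhds_unique h1 ?_
  simp only [hTA]
  exact h2

theorem eq_smul_one_of_mem_of_mem_commutant (hT : IsLimitOfAverages hB π τ T)
    (hconv : ∀ η : H, ‖η‖ = 1 → Tendsto (fun n => restrictNorm (τ - vectorFunctional π η)
      (StarSubalgebra.centralizer ℂ (B n : Set A))) atTop (𝓝 0))
    {x : H →L[ℂ] H} (hx : x ∈ bicommutant π.range) (hx' : x ∈ (bicommutant π.range).commutant) :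
    x = T x • (1 : H →L[ℂ] H) := by
  have hunit : ∀ η : H, ‖η‖ = 1 → ⟪η, x η⟫_ℂ = T x := by
    intro η hη
    have hΨ : ∀ n, hB.averagedState π η n x = ⟪η, x η⟫_ℂ := by
      intro n
      have := hB.nonempty_fin n
      refine averagedVectorFunctional_of_commute (hB.isMatrixUnits_map π n) η fun i j => ?_
      exact VonNeumannAlgebra.mem_commutant_iff.mp hx' _ (apply_mem_bicommutant π _)
    have h1 : Tendsto (fun n => restrictNorm (τ - vectorFunctional π η)
      (StarSubalgebra.centralizer ℂ (B n : Set A)) * (2 * ‖x‖)) atTop (𝓝 0) := by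
      simpa using (hconv η hη).mul_const (2 * ‖x‖)
    have h2 : ‖T x - ⟪η, x η⟫_ℂ‖ ≤ 0 := ge_of_tendsto' h1 fun n => by
      rw [← hΨ n]; exact hT η n x hx
    exact (sub_eq_zero.mp (norm_le_zero_iff.mp h2)).symm
  have hall : ∀ v : H, ⟪v, x v⟫_ℂ = ⟪v, T x • v⟫_ℂ := by
    intro v
    rcases eq_or_ne v 0 with rfl | hv
    · simp
    have hv0 : (‖v‖ : ℂ) ≠ 0 := by exact_mod_cast norm_ne_zero_iff.mpr hv
    have h1 := hunit ((‖v‖ : ℂ)⁻¹ • v) (by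
      rw [norm_smul, norm_inv, Complex.norm_real, norm_norm,
        inv_mul_cancel₀ (norm_ne_zero_iff.mpr hv)])
    rw [map_smul, inner_smul_left, inner_smul_right, map_inv₀, Complex.conj_ofReal] at h1
    rw [inner_smul_right, inner_self_eq_norm_sq_to_K, ← h1]
    field_simp
    rfl
  have h := (ext_inner_map (x : H →ₗ[ℂ] H) ((T x • (1 : H →L[ℂ] H) : H →L[ℂ] H) : H →ₗ[ℂ] H)).mp
    fun v => by
      change ⟪x v, v⟫_ℂ = ⟪T x • v, v⟫_ℂ
      rw [← inner_conj_symm, hall, inner_conj_symm]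
  exact ContinuousLinearMap.coe_injective h

end Trace

end Main

/-! ### Faithfulness of the trace -/

section Faithful

variable {H : Type*} [NormedAddCommGroup H] [InnerProductSpace ℂ H] [CompleteSpace H]
  {ι : Type*} [Fintype ι] [DecidableEq ι] {e : ι → ι → (H →L[ℂ] H)}

/-- The average of `x* x` dominates a positive multiple of `x* x`, since `v = ∑ i, e i i v`. -/
theorem norm_apply_sq_le_inner_matrixAverage [Nonempty ι] (he : IsMatrixUnits e)
    (x : H →L[ℂ] H) (v : H) :
    ‖x v‖ ^ 2 ≤ (Fintype.card ι : ℝ) ^ 2 * (⟪v, matrixAverage e (star x * x) v⟫_ℂ).re := by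
  have hk : (0 : ℝ) < Fintype.card ι := by exact_mod_cast Fintype.card_pos
  have h1 : (⟪v, matrixAverage e (star x * x) v⟫_ℂ).re
      = (Fintype.card ι : ℝ)⁻¹ * ∑ i, ∑ j, ‖x (e j i v)‖ ^ 2 := by
    rw [← averagedVectorFunctional_apply, averagedVectorFunctional_eq_sum he]
    have h2 : ∀ i j, ⟪e j i v, (star x * x) (e j i v)⟫_ℂ = ((‖x (e j i v)‖ ^ 2 : ℝ) : ℂ) := by
      intro i j
      rw [mul_apply_eq_comp, ContinuousLinearMap.star_eq_adjoint,
        ContinuousLinearMap.adjoint_inner_right, inner_self_eq_norm_sq_to_K]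
      simp
    simp only [h2]
    rw [← Complex.ofReal_natCast, ← Complex.ofReal_inv]
    simp only [← Complex.ofReal_sum]
    rw [← Complex.ofReal_mul, Complex.ofReal_re]
  have h3 : x v = ∑ i, x (e i i v) := by
    rw [← map_sum, ← sum_apply, he.sum_one, one_apply_eq_self]
  have h4 : ‖x v‖ ^ 2 ≤ (Fintype.card ι : ℝ) * ∑ i, ‖x (e i i v)‖ ^ 2 := by
    have h5 : ‖x v‖ ≤ ∑ i, ‖x (e i i v)‖ := by rw [h3]; exact norm_sum_le _ _
    refine (pow_le_pow_left₀ (norm_nonneg _) h5 2).trans ?_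
    simpa using sq_sum_le_card_mul_sum_sq (s := Finset.univ) (f := fun i => ‖x (e i i v)‖)
  have h6 : ∑ i, ‖x (e i i v)‖ ^ 2 ≤ ∑ i, ∑ j, ‖x (e j i v)‖ ^ 2 :=
    Finset.sum_le_sum fun i _ =>
      Finset.single_le_sum (f := fun j => ‖x (e j i v)‖ ^ 2) (fun j _ => sq_nonneg _)
        (Finset.mem_univ i)
  rw [h1, pow_two (Fintype.card ι : ℝ), mul_assoc, mul_inv_cancel_left₀ hk.ne']
  exact h4.trans (mul_le_mul_of_nonneg_left h6 hk.le)

/-- A bound for `v = (s + δ)⁻¹ x* x η`, where `s` is the average of `x* x`, which shows that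
`δ ‖v‖ = O(√δ)`. -/
theorem mul_norm_sq_le_of_matrixAverage_add_smul [Nonempty ι] (he : IsMatrixUnits e)
    (x : H →L[ℂ] H) {v η : H} {δ : ℝ}
    (hv : matrixAverage e (star x * x) v + (δ : ℂ) • v = (star x * x) η) :
    δ * ‖v‖ ^ 2 ≤ ‖x η‖ ^ 2 * (Fintype.card ι : ℝ) ^ 2 / 4 := by
  have hK : (0 : ℝ) < Fintype.card ι := by exact_mod_cast Fintype.card_pos
  have h1 := norm_apply_sq_le_inner_matrixAverage he x v
  set q := (⟪v, matrixAverage e (star x * x) v⟫_ℂ).re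
  set K : ℝ := (Fintype.card ι : ℝ)
  set C : ℝ := ‖x η‖
  have h2 : q + δ * ‖v‖ ^ 2 ≤ ‖x v‖ * C := by
    have h3 : ⟪v, matrixAverage e (star x * x) v⟫_ℂ + ((δ * ‖v‖ ^ 2 : ℝ) : ℂ)
        = ⟪x v, x η⟫_ℂ := by
      rw [← ContinuousLinearMap.adjoint_inner_right x, ← ContinuousLinearMap.star_eq_adjoint,
        ← mul_apply_eq_comp, ← hv, inner_add_right, inner_smul_right, inner_self_eq_norm_sq_to_K]
      simp
    have h4 := congrArg Complex.re h3
    rw [Complex.add_re, Complex.ofReal_re] at h4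
    rw [h4]
    exact (Complex.re_le_norm _).trans (norm_inner_le_norm _ _)
  -- Complete the square in `‖x v‖`.
  have h5 : ‖x v‖ * C ≤ q + C ^ 2 * K ^ 2 / 4 := by
    by_contra! h6
    have h7 : K ^ 2 * (q + C ^ 2 * K ^ 2 / 4) < K ^ 2 * (‖x v‖ * C) :=
      mul_lt_mul_of_pos_left h6 (by positivity)
    nlinarith [sq_nonneg (‖x v‖ - C * K ^ 2 / 2)]
  linarith

theorem exists_resolvent_of_nonneg {s : H →L[ℂ] H} (hs : 0 ≤ s) {δ : ℝ} (hδ : 0 < δ) :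
    ∃ r : H →L[ℂ] H, (∀ c, Commute s c → Commute r c) ∧ s * r + (δ : ℂ) • r = 1 ∧
      ‖r * s‖ ≤ 1 := by
  -- On the spectrum of `s` the function below is `(t + δ)⁻¹`.
  have hcont : Continuous fun t : ℝ => (max t 0 + δ)⁻¹ :=
    (by fun_prop : Continuous fun t : ℝ => max t 0 + δ).inv₀ fun t => by positivity
  have hsa : IsSelfAdjoint s := IsSelfAdjoint.of_nonneg hs
  have hspec : ∀ t ∈ spectrum ℝ s, 0 ≤ t := fun t ht => spectrum_nonneg_of_nonneg hs ht
  have hsr : s * cfc (fun t : ℝ => (max t 0 + δ)⁻¹) s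
      = cfc (fun t : ℝ => t * (max t 0 + δ)⁻¹) s := by
    rw [cfc_mul (fun t : ℝ => t) _ s (by fun_prop) hcont.continuousOn, cfc_id' ℝ s]
  refine ⟨cfc (fun t : ℝ => (max t 0 + δ)⁻¹) s, fun c hc => hc.cfc_real _, ?_, ?_⟩
  · rw [hsr, Complex.coe_smul, ← cfc_smul δ _ s hcont.continuousOn,
      ← cfc_add s (fun t : ℝ => t * (max t 0 + δ)⁻¹) (fun t : ℝ => δ • (max t 0 + δ)⁻¹)
        (continuous_id.mul hcont).continuousOn (hcont.const_smul δ).continuousOn,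
      ← cfc_one ℝ s]
    refine cfc_congr fun t ht => ?_
    have := hspec t ht
    simp only [max_eq_left this, smul_eq_mul, Pi.one_apply]
    field_simp
  · rw [((Commute.refl s).cfc_real _).eq, hsr]
    refine norm_cfc_le zero_le_one fun t ht => ?_
    have := hspec t ht
    rw [max_eq_left this, norm_mul, norm_inv, Real.norm_of_nonneg this,
      Real.norm_of_nonneg (by positivity), ← div_eq_mul_inv, div_le_one (by positivity)]
    linarith

variable {A : Type*} [CStarAlgebra A] {B : ℕ → StarSubalgebra ℂ A} {k : ℕ → ℕ}
  (hB : IsUHFSequence B k) (π : A →⋆ₐ[ℂ] (H →L[ℂ] H)) {τ : StrongDual ℂ A}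
  {T : StrongDual ℂ (H →L[ℂ] H)}

/-- The limit trace is faithful. If `T (x* x) = 0` and `ξ = x* x η` is a unit vector, let `s` be
the average of `x* x` over the `n`-th matrix algebra. Then `s (s + δ)⁻¹` is a contraction in the
null ideal of `T` that commutes with the `n`-th matrix algebra, so the vector state of `ξ` is
small on it for large `n`; but `s (s + δ)⁻¹ ξ` tends to `ξ` as `δ → 0`. -/
theorem eq_zero_of_trace_star_mul_self_eq_zero (hT : IsLimitOfAverages hB π τ T)
    (hconv : ∀ η : H, ‖η‖ = 1 → Tendsto (fun n => restrictNorm (τ - vectorFunctional π η)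
      (StarSubalgebra.centralizer ℂ (B n : Set A))) atTop (𝓝 0))
    (hTpos : ∀ x, 0 ≤ T (star x * x)) (hTA : ∀ a x, T (π a * x) = T (x * π a))
    {x : H →L[ℂ] H} (hx : x ∈ bicommutant π.range) (hx0 : T (star x * x) = 0) : x = 0 := by
  by_contra hne
  set M := (bicommutant π.range).toStarSubalgebra
  replace hx : x ∈ M := hx
  obtain ⟨η₀, hη₀⟩ : ∃ η, x η ≠ 0 := by
    by_contra! h
    exact hne (ContinuousLinearMap.ext h)
  set h := star x * x with hh
  have hadj : ∀ u v : H, ⟪u, h v⟫_ℂ = ⟪x u, x v⟫_ℂ := fun u v => by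
    rw [hh, mul_apply_eq_comp, ContinuousLinearMap.star_eq_adjoint,
      ContinuousLinearMap.adjoint_inner_right]
  have hhη₀ : h η₀ ≠ 0 := fun h0 => hη₀ <| by
    have := hadj η₀ η₀
    rw [h0, inner_zero_right] at this
    exact inner_self_eq_zero.mp this.symm
  -- Normalize so that `ξ = x* x η` is a unit vector.
  let η : H := ((‖h η₀‖ : ℂ)⁻¹) • η₀
  let ξ : H := h η
  have hξ : ‖ξ‖ = 1 := by
    simp only [ξ, η]
    rw [map_smul, norm_smul, norm_inv, Complex.norm_real, norm_norm,
      inv_mul_cancel₀ (norm_ne_zero_iff.mpr hhη₀)]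
  obtain ⟨n, hn⟩ := ((hconv ξ hξ).eventually_lt_const (show (0 : ℝ) < 1 / 8 by norm_num)).exists
  have := hB.nonempty_fin n
  have he := hB.isMatrixUnits_map π n
  set e : Fin (k n) → Fin (k n) → (H →L[ℂ] H) := fun i j => π (hB.unit n i j) with hedef
  have hrange : ∀ a, π a ∈ M := apply_mem_bicommutant π
  have hhM : h ∈ M := mul_mem (star_mem hx) hx
  set s := matrixAverage e h with hs
  have hsM : s ∈ M := M.smul_mem (M.sum_mem fun i _ => M.sum_mem fun j _ =>
    M.mul_mem (M.mul_mem (hrange _) hhM) (hrange _)) _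
  have hspos : 0 ≤ s := he.matrixAverage_nonneg (star_mul_self_nonneg x)
  set K : ℝ := (Fintype.card (Fin (k n)) : ℝ) with hK
  set C : ℝ := ‖x η‖
  -- With this `δ` the vector `δ (s + δ)⁻¹ ξ` has norm at most `1 / 2`.
  let δ : ℝ := 1 / (C ^ 2 * K ^ 2 + 1)
  have hδ : 0 < δ := by positivity
  obtain ⟨r, hcomm, hsr1, hnorm⟩ := exists_resolvent_of_nonneg hspos hδ
  have hcommr : Commute s r := (hcomm s (Commute.refl s)).symm
  have hrM : r ∈ M := by
    have h1 : r ∈ (bicommutant π.range : Set (H →L[ℂ] H)) := by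
      rw [coe_bicommutant]
      intro c hc
      have h2 : s ∈ (bicommutant π.range : Set (H →L[ℂ] H)) := hsM
      rw [coe_bicommutant] at h2
      have h3 : Commute s c := (h2 c hc).symm
      exact (hcomm c h3).eq.symm
    exact h1
  have hes : ∀ i j, e i j * s = s * e i j := fun i j => he.commute_matrixAverage i j h
  have her : ∀ i j, e i j * (r * s) = r * s * e i j := by
    intro i j
    have h1 : Commute s (e i j) := (hes i j).symm
    have h2 : Commute r (e i j) := hcomm _ h1
    exact ((h2.mul_left h1).eq).symm
  have hTe : T (r * s) = 0 := by
    have h1 : r * s = (Fintype.card (Fin (k n)) : ℂ)⁻¹ •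
        ∑ i, ∑ j, r * (e i j * h * e j i) := by
      rw [hs, matrixAverage_apply, mul_smul_comm]
      simp only [Finset.mul_sum]
    rw [h1, map_smul, map_sum]
    refine smul_eq_zero_of_right _ (Finset.sum_eq_zero fun i _ => ?_)
    rw [map_sum]
    refine Finset.sum_eq_zero fun j _ => ?_
    have h2 : r * (e i j * h * e j i) = (r * e i j * star x * x) * e j i := by
      rw [hh]; noncomm_ring
    have h3 : e j i * (r * e i j * star x * x) = (e j i * r * e i j * star x) * x := by
      noncomm_ring
    rw [h2, hedef, ← hTA]
    change T (e j i * (r * e i j * star x * x)) = 0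
    rw [h3]
    exact apply_mul_eq_zero_of_apply_star_mul_self_eq_zero (f := (T : (H →L[ℂ] H) →ₗ[ℂ] ℂ))
      hTpos hx0 _
  have hsmall : ‖⟪ξ, (r * s) ξ⟫_ℂ‖ < 1 / 4 := by
    have h1 := hT ξ n (r * s) (M.mul_mem hrM hsM)
    have h2 : hB.averagedState π ξ n (r * s) = ⟪ξ, (r * s) ξ⟫_ℂ :=
      averagedVectorFunctional_of_commute he ξ her
    rw [hTe, h2, zero_sub, norm_neg] at h1
    have h3 := restrictNorm_nonneg (τ - vectorFunctional π ξ)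
      (StarSubalgebra.centralizer ℂ (B n : Set A))
    nlinarith [norm_nonneg (r * s)]
  let v : H := r ξ
  have hv : s v + (δ : ℂ) • v = ξ := by
    have := DFunLike.congr_fun hsr1 ξ
    simpa using this
  have hlarge : 1 - δ * ‖v‖ ≤ ‖⟪ξ, (r * s) ξ⟫_ℂ‖ := by
    have h1 : (r * s) ξ = ξ - (δ : ℂ) • v := by
      rw [← hcommr.eq, mul_apply_eq_comp]
      exact eq_sub_of_add_eq hv
    rw [h1, inner_sub_right, inner_self_eq_norm_sq_to_K, hξ, inner_smul_right]
    have h2 := norm_sub_norm_le (1 : ℂ) ((δ : ℂ) * ⟪ξ, v⟫_ℂ)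
    have h3 : ‖(δ : ℂ) * ⟪ξ, v⟫_ℂ‖ ≤ δ * ‖v‖ := by
      rw [norm_mul, Complex.norm_real, Real.norm_of_nonneg hδ.le]
      have := norm_inner_le_norm (𝕜 := ℂ) ξ v
      rw [hξ, one_mul] at this
      exact mul_le_mul_of_nonneg_left this hδ.le
    rw [norm_one] at h2
    refine le_trans (by linarith) (h2.trans_eq ?_)
    simp
  have hbound : δ * ‖v‖ ^ 2 ≤ C ^ 2 * K ^ 2 / 4 := by
    refine mul_norm_sq_le_of_matrixAverage_add_smul he x ?_
    rw [hv]
  have hfinal : (δ * ‖v‖) ^ 2 ≤ 1 / 4 := by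
    have h1 : (δ * ‖v‖) ^ 2 = δ * (δ * ‖v‖ ^ 2) := by ring
    rw [h1]
    refine (mul_le_mul_of_nonneg_left hbound hδ.le).trans ?_
    simp only [δ]
    rw [div_mul_div_comm, div_le_div_iff₀ (by positivity) (by norm_num)]
    nlinarith
  nlinarith [mul_nonneg hδ.le (norm_nonneg v)]

end Faithful

/-! ### The generated von Neumann algebra -/

section Equivalence

variable {A : Type*} [CStarAlgebra A] {H : Type*} [NormedAddCommGroup H] [InnerProductSpace ℂ H]
  [CompleteSpace H] {B : ℕ → StarSubalgebra ℂ A} {k : ℕ → ℕ}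

namespace IsUHFSequence

theorem centralizer_range (hB : IsUHFSequence B k) (π : A →⋆ₐ[ℂ] (H →L[ℂ] H)) :
    Set.centralizer (π.range : Set (H →L[ℂ] H))
      = Set.centralizer (⋃ n, (((B n).map π : StarSubalgebra ℂ (H →L[ℂ] H)) :
        Set (H →L[ℂ] H))) := by
  refine Set.Subset.antisymm (Set.centralizer_subset ?_) ?_
  · refine Set.iUnion_subset fun n => ?_
    rintro _ ⟨b, -, rfl⟩
    exact ⟨b, rfl⟩
  · rintro c hc _ ⟨a, rfl⟩
    have hπ := continuous_starAlgHom π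
    have hcl : IsClosed {a : A | π a * c = c * π a} := isClosed_eq (by fun_prop) (by fun_prop)
    have hsub : (⋃ n, (B n : Set A)) ⊆ {a : A | π a * c = c * π a} := by
      intro b hb
      obtain ⟨n, hn⟩ := Set.mem_iUnion.mp hb
      exact hc _ (Set.mem_iUnion.mpr ⟨n, ⟨b, hn, rfl⟩⟩)
    exact closure_minimal hsub hcl (hB.dense a)

theorem finiteDimensional (hB : IsUHFSequence B k) (n : ℕ) : FiniteDimensional ℂ (B n) := by
  obtain ⟨φ⟩ := hB.matrix n
  exact LinearEquiv.finiteDimensional (φ.symm.toAlgEquiv.toLinearEquiv)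

theorem isHyperfinite_bicommutant (hB : IsUHFSequence B k) (π : A →⋆ₐ[ℂ] (H →L[ℂ] H)) :
    IsHyperfinite (bicommutant π.range) := by
  refine ⟨fun n => (B n).map π, fun n m hnm => StarSubalgebra.map_mono (hB.mono hnm),
    fun n => ?_, ?_⟩
  · have := hB.finiteDimensional n
    have h : FiniteDimensional ℂ
        ((Subalgebra.toSubmodule (B n).toSubalgebra).map π.toAlgHom.toLinearMap) := by
      have : FiniteDimensional ℂ (Subalgebra.toSubmodule (B n).toSubalgebra) := this
      infer_instance
    exact h
  · rw [coe_bicommutant, hB.centralizer_range π]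

theorem not_finiteDimensional_bicommutant [Nontrivial H] (hB : IsUHFSequence B k)
    (π : A →⋆ₐ[ℂ] (H →L[ℂ] H)) :
    ¬ FiniteDimensional ℂ (bicommutant π.range).toStarSubalgebra := by
  intro hfd
  obtain ⟨n, hn⟩ := (hB.unbounded.eventually (eventually_gt_atTop
    (Module.finrank ℂ (bicommutant π.range).toStarSubalgebra))).exists
  have h1 := (hB.isMatrixUnits_map π n).linearIndependent_diag
  let g : Fin (k n) → (bicommutant π.range).toStarSubalgebra := fun i =>
    ⟨π (hB.unit n i i), apply_mem_bicommutant π _⟩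
  have h2 : LinearIndependent ℂ g :=
    LinearIndependent.of_comp
      (Subalgebra.toSubmodule (bicommutant π.range).toStarSubalgebra.toSubalgebra).subtype h1
  have h3 := h2.fintype_card_le_finrank
  rw [Fintype.card_fin] at h3
  exact absurd hn (not_lt.mpr h3)

theorem isHyperfiniteIIOneFactor_bicommutant [Nontrivial H] (hB : IsUHFSequence B k)
    (π : A →⋆ₐ[ℂ] (H →L[ℂ] H)) {τ : StrongDual ℂ A} (hτ : IsTracialState (τ : A →ₗ[ℂ] ℂ))
    (hconv : ∀ η : H, ‖η‖ = 1 → Tendsto (fun n => restrictNorm (τ - vectorFunctional π η)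
      (StarSubalgebra.centralizer ℂ (B n : Set A))) atTop (𝓝 0)) :
    IsHyperfiniteIIOneFactor (bicommutant π.range) := by
  obtain ⟨ζ, hζ⟩ := exists_norm_eq H zero_le_one
  obtain ⟨T, hT1, hTpos, hTA, hT⟩ := exists_trace_on_bicommutant hB π hτ hζ (hconv ζ hζ)
  refine ⟨⟨fun x hx hx' => ⟨T x, eq_smul_one_of_mem_of_mem_commutant hB π hT hconv hx hx'⟩,
    hB.not_finiteDimensional_bicommutant π, ?_⟩, hB.isHyperfinite_bicommutant π⟩
  refine ⟨(T : (H →L[ℂ] H) →ₗ[ℂ] ℂ).comp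
    (Subalgebra.toSubmodule (bicommutant π.range).toStarSubalgebra.toSubalgebra).subtype,
    ⟨hT1, fun a => hTpos a, fun a b => ?_⟩, ?_, fun x hx => ?_⟩
  · exact trace_mul_comm hB π hT (hconv ζ hζ) hTA a.2 b.2
  · rw [IsNormalFunctional, continuous_iff_continuousAt]
    intro x
    refine tendsto_trace hB π hT (hconv ζ hζ) (C := 1) x.2.1
      (Eventually.of_forall fun y => y.2) fun η => ?_
    have h := (ContinuousLinearMapWOT.tendsto_iff_forall_inner_apply_tendsto).mp
      (continuous_subtype_val.tendsto x) η η
    exact h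
  · exact Subtype.ext (eq_zero_of_trace_star_mul_self_eq_zero hB π hT hconv hTpos hTA x.2 hx)

/-- In a II₁ factor a bounded sequence that asymptotically commutes with `π(A)` has only scalar
weak limit points `c`, and both the trace and every vector state converge to `c` along it. Here
the sequence is an almost norming one for `τ - φ_η` on the relative commutants. -/
theorem tendsto_restrictNorm_of_isIIOneFactor (hB : IsUHFSequence B k)
    (π : A →⋆ₐ[ℂ] (H →L[ℂ] H)) {τ : StrongDual ℂ A} (hτ : IsTracialState (τ : A →ₗ[ℂ] ℂ))
    (hM : IsIIOneFactor (bicommutant π.range)) {η : H} (hη : ‖η‖ = 1) :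
    Tendsto (fun n => restrictNorm (τ - vectorFunctional π η)
      (StarSubalgebra.centralizer ℂ (B n : Set A))) atTop (𝓝 0) := by
  obtain ⟨T, hT, hTn, -⟩ := hM.trace
  have hπn : ∀ a, ‖π a‖ ≤ ‖a‖ := fun a => NonUnitalStarAlgHom.norm_apply_le π a
  -- The composition of the trace with `π` is the trace of `A`.
  let σ₀ : A →ₗ[ℂ] ℂ := T.comp (LinearMap.codRestrict
    (Subalgebra.toSubmodule (bicommutant π.range).toStarSubalgebra.toSubalgebra)
    π.toAlgHom.toLinearMap (apply_mem_bicommutant π))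
  have hcont : Continuous σ₀ := by
    refine continuous_of_continuousAt_zero σ₀ ?_
    have hball : ContinuousOn σ₀ (Metric.closedBall 0 1) := by
      rw [continuousOn_iff_continuous_domRestrict]
      let g : Metric.closedBall (0 : A) 1 → {x : H →WOT[ℂ] H //
          x.toCLM ∈ (bicommutant π.range).toStarSubalgebra ∧ ‖x.toCLM‖ ≤ 1} := fun a =>
        ⟨ContinuousLinearMapWOT.ofCLM (π a), apply_mem_bicommutant π _,
          (hπn _).trans (mem_closedBall_zero_iff.mp a.2)⟩
      have hg : Continuous g := by
        refine Continuous.subtype_mk ?_ _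
        exact ContinuousLinearMapWOT.continuous_ofCLM.comp
          ((continuous_starAlgHom π).comp continuous_subtype_val)
      exact hTn.comp hg
    exact hball.continuousAt (Metric.closedBall_mem_nhds 0 one_pos)
  let σ : StrongDual ℂ A := ⟨σ₀, hcont⟩
  have hσ : IsTracialState (σ : A →ₗ[ℂ] ℂ) := by
    refine ⟨?_, fun a => ?_, fun a b => ?_⟩
    · change T ⟨π 1, _⟩ = 1
      rw [← hT.map_one]
      congr 1
      exact Subtype.ext (map_one π)
    · change 0 ≤ T ⟨π (star a * a), _⟩
      convert hT.nonneg ⟨π a, apply_mem_bicommutant π a⟩ using 2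
      exact Subtype.ext ((map_mul π _ _).trans (congrArg (· * π a) (map_star π a)))
    · change T ⟨π (a * b), _⟩ = T ⟨π (b * a), _⟩
      convert hT.trace ⟨π a, apply_mem_bicommutant π a⟩ ⟨π b, apply_mem_bicommutant π b⟩ using 2
      · exact Subtype.ext (by simp)
      · exact Subtype.ext (by simp)
  have hτT : ∀ a, τ a = T ⟨π a, apply_mem_bicommutant π a⟩ := fun a => by
    rw [hB.eq_of_isTracialState hτ hσ]
    rfl
  -- Almost norming elements of the relative commutants.
  set f := τ - vectorFunctional π η with hf
  have hex : ∀ n : ℕ, ∃ c ∈ StarSubalgebra.centralizer ℂ (B n : Set A), ‖c‖ ≤ 1 ∧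
      restrictNorm f (StarSubalgebra.centralizer ℂ (B n : Set A)) - 1 / ((n : ℝ) + 1) < ‖f c‖ :=
    fun n => exists_lt_norm_apply_of_lt_restrictNorm f _
      (sub_lt_self _ (by positivity))
  choose b hbC hb1 hbf using hex
  rw [tendsto_iff_ultrafilter]
  intro 𝒰 h𝒰
  obtain ⟨y, hy1, hy⟩ := exists_ultrafilter_limit_operator 𝒰 zero_le_one
    (f := fun n => π (b n)) fun n => (hπn _).trans (hb1 n)
  have hyc : y ∈ Set.centralizer (π.range : Set (H →L[ℂ] H)) := by
    rw [hB.centralizer_range π]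
    intro c hc
    obtain ⟨m, hm⟩ := Set.mem_iUnion.mp hc
    obtain ⟨a, ha, rfl⟩ := hm
    refine ContinuousLinearMap.ext fun v => ext_inner_left ℂ fun w => ?_
    have h1 : Tendsto (fun n => ⟪w, π a (π (b n) v)⟫_ℂ) 𝒰 (𝓝 ⟪w, π a (y v)⟫_ℂ) := by
      simp only [← ContinuousLinearMap.adjoint_inner_left (π a)]
      exact hy v _
    refine tendsto_nhds_unique h1 ((hy (π a v) w).congr' (h𝒰 ?_))
    filter_upwards [eventually_ge_atTop m] with n hn
    have h2 := (StarSubalgebra.mem_centralizer_iff ℂ).mp (hbC n) a (hB.mono hn ha)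
    rw [← mul_apply_eq_comp, ← mul_apply_eq_comp, ← map_mul, ← map_mul, h2.1]
  have hyM : y ∈ bicommutant π.range := by
    rw [← SetLike.mem_coe, coe_bicommutant]
    intro c hc
    refine ContinuousLinearMap.ext fun v => ext_inner_left ℂ fun w => ?_
    have h1 : Tendsto (fun n => ⟪w, c (π (b n) v)⟫_ℂ) 𝒰 (𝓝 ⟪w, c (y v)⟫_ℂ) := by
      simp only [← ContinuousLinearMap.adjoint_inner_left c]
      exact hy v _
    refine tendsto_nhds_unique h1 ((hy (c v) w).congr fun n => ?_)
    have h2 := hc (π (b n)) ⟨b n, rfl⟩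
    rw [← mul_apply_eq_comp, ← mul_apply_eq_comp, h2]
  have hyM' : y ∈ (bicommutant π.range).commutant := by
    rw [VonNeumannAlgebra.mem_commutant_iff]
    intro g hg
    rw [← SetLike.mem_coe, coe_bicommutant] at hg
    exact (hg y hyc).symm
  obtain ⟨c, hc⟩ := hM.factor y hyM hyM'
  have hlimT : Tendsto (fun n => τ (b n)) 𝒰 (𝓝 c) := by
    have h1 : Tendsto (fun n => (⟨ContinuousLinearMapWOT.ofCLM (π (b n)),
        apply_mem_bicommutant π _, (hπn _).trans (hb1 n)⟩ : {x : H →WOT[ℂ] H //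
          x.toCLM ∈ (bicommutant π.range).toStarSubalgebra ∧ ‖x.toCLM‖ ≤ 1})) 𝒰
        (𝓝 ⟨ContinuousLinearMapWOT.ofCLM y, hyM, hy1⟩) := by
      rw [tendsto_subtype_rng]
      exact ContinuousLinearMapWOT.tendsto_iff_forall_inner_apply_tendsto.mpr hy
    have h2 := (hTn.tendsto _).comp h1
    have h3 : T ⟨y, hyM⟩ = c := by
      have h4 : (⟨y, hyM⟩ : (bicommutant π.range).toStarSubalgebra) = c • 1 := Subtype.ext hc
      rw [h4, map_smul, hT.map_one, smul_eq_mul, mul_one]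
    rw [← h3]
    exact h2.congr fun n => (hτT (b n)).symm
  have hlimφ : Tendsto (fun n => vectorFunctional π η (b n)) 𝒰 (𝓝 c) := by
    have h1 := hy η η
    rw [hc, smul_apply, one_apply_eq_self, inner_smul_right, inner_self_eq_norm_sq_to_K, hη] at h1
    simpa [vectorFunctional_apply] using h1
  have hlimf : Tendsto (fun n => ‖f (b n)‖ + 1 / ((n : ℝ) + 1)) 𝒰 (𝓝 0) := by
    have h1 := (hlimT.sub hlimφ).norm
    rw [sub_self, norm_zero] at h1
    simpa [hf] using h1.add (tendsto_one_div_add_atTop_nhds_zero_nat.mono_left h𝒰)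
  exact squeeze_zero (fun n => restrictNorm_nonneg _ _)
    (fun n => (sub_lt_iff_lt_add.mp (hbf n)).le) hlimf

end IsUHFSequence

/-- Convergence on a dense set of unit vectors gives convergence on all of them, since vector
functionals depend continuously on the vector in norm. -/
theorem tendsto_restrictNorm_of_mem_closure (π : A →⋆ₐ[ℂ] (H →L[ℂ] H)) (τ : StrongDual ℂ A)
    {C : ℕ → StarSubalgebra ℂ A} {S : Set H} (hS : ∀ ξ ∈ S, ‖ξ‖ = 1)
    (hconv : ∀ ξ ∈ S, Tendsto (fun n => restrictNorm (τ - vectorFunctional π ξ) (C n))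
      atTop (𝓝 0)) {η : H} (hη : ‖η‖ = 1) (hηS : η ∈ closure S) :
    Tendsto (fun n => restrictNorm (τ - vectorFunctional π η) (C n)) atTop (𝓝 0) := by
  rw [Metric.tendsto_atTop]
  intro ε hε
  obtain ⟨ξ, hξS, hξ⟩ := Metric.mem_closure_iff.mp hηS (ε / 4) (by positivity)
  obtain ⟨N, hN⟩ := Metric.tendsto_atTop.mp (hconv ξ hξS) (ε / 2) (by positivity)
  refine ⟨N, fun n hn => ?_⟩
  have h1 := hN n hn
  rw [Real.dist_0_eq_abs, abs_of_nonneg (restrictNorm_nonneg _ _)] at h1 ⊢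
  have h2 := restrictNorm_le_add (τ - vectorFunctional π η) (τ - vectorFunctional π ξ) (C n)
  have h3 := norm_vectorFunctional_sub_le π (hS ξ hξS) hη
  rw [sub_sub_sub_cancel_left] at h2
  rw [dist_comm, dist_eq_norm] at hξ
  linarith

end Equivalence

theorem lemma6p1 {A : Type*} [CStarAlgebra A] {H : Type*} [NormedAddCommGroup H]
    [InnerProductSpace ℂ H] [CompleteSpace H] [TopologicalSpace.SeparableSpace H]
    (B : ℕ → StarSubalgebra ℂ A) (k : ℕ → ℕ) (hB : IsUHFSequence B k)
    (π : A →⋆ₐ[ℂ] (H →L[ℂ] H))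
    (ξ : ℕ → H) (hξ : ∀ m, ‖ξ m‖ = 1) (hξd : ∀ η : H, ‖η‖ = 1 → η ∈ closure (Set.range ξ)) :
    (∃! τ : StrongDual ℂ A, IsTracialState (τ : A →ₗ[ℂ] ℂ)) ∧
    ∀ τ : StrongDual ℂ A, IsTracialState (τ : A →ₗ[ℂ] ℂ) →
      List.TFAE [
        IsHyperfiniteIIOneFactor (bicommutant π.range),
        ∀ η : H, ‖η‖ = 1 → Tendsto
          (fun n => restrictNorm (τ - vectorFunctional π η)
            (StarSubalgebra.centralizer ℂ (B n : Set A))) atTop (𝓝 0),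
        ∀ m : ℕ, Tendsto
          (fun n => restrictNorm (τ - vectorFunctional π (ξ m))
            (StarSubalgebra.centralizer ℂ (B n : Set A))) atTop (𝓝 0)] := by
  have : Nontrivial H := ⟨ξ 0, 0, fun h => by simpa [h] using hξ 0⟩
  refine ⟨?_, fun τ hτ => ?_⟩
  · obtain ⟨τ, hτ⟩ := hB.exists_isTracialState π (hξ 0)
    exact ⟨τ, hτ, fun σ hσ => hB.eq_of_isTracialState hσ hτ⟩
  · tfae_have 1 → 2 := fun h η hη => hB.tendsto_restrictNorm_of_isIIOneFactor π hτ h.1 hη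
    tfae_have 2 → 1 := fun h => hB.isHyperfiniteIIOneFactor_bicommutant π hτ h
    tfae_have 2 → 3 := fun h m => h (ξ m) (hξ m)
    tfae_have 3 → 2 := fun h η hη => tendsto_restrictNorm_of_mem_closure π τ
      (S := Set.range ξ) (by rintro _ ⟨m, rfl⟩; exact hξ m) (by rintro _ ⟨m, rfl⟩; exact h m)
      hη (hξd η hη)
    tfae_finish
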